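/- A chord diagram with $m$ chords is a set of $m$ disjoint properly embedded arcs (chords) in a disc, with $2m$ fixed marked endpoints on the boundary circle, one of them the base point, up to homotopy relative to endpoints. Two chord diagrams are \emph{bypass-related} if they are distinct and one is obtained from the other by a bypass move: they agree outside a sub-disc in which each consists of three parallel arcs, and there they differ by a rotation of the sub-disc by $\pm 60^\circ$. The three diagrams obtained from the three rotations of the three arcs form a \emph{bypass triple}. Let $SFH_{comb}(T,m)$ be the $\mathbb Z_2$-vector space generated by the chord diagrams with $m$ chords, subject to the relations $\Gamma_1+\Gamma_2+\Gamma_3=0$ for all bypass triples. For a word $w = s_1 s_2 \cdots s_n$ in the symbols $-,+$, let $\Gamma_w = B_{s_1} B_{s_2} \cdots B_{s_n} \Gamma_\emptyset$ be the chord diagram with $n+1$ chords obtained from the unique diagram $\Gamma_\emptyset$ with one chord, where $B_+$ (resp. $B_-$) adds an outermost chord joining the new base point to the next marked point clockwise (resp. anticlockwise) from it, the old base point becoming the marked point immediately clockwise (resp. anticlockwise) of the new chord. Let $v_w$ be the class of $\Gamma_w$. \textbf{Proposition (Size of basis decomposition).} Let $n \ge 0$. The elements $v_w$, for $w$ a word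 of length $n$, form a basis of $SFH_{comb}(T,n+1)$. Let $\Gamma$ be a chord diagram with $n+1$ chords which is not one of the diagrams $\Gamma_w$, and write its class as the sum $v_{w_1} + \cdots + v_{w_N}$ of distinct basis elements, with $w_1 < \cdots < w_N$ in the lexicographic order in which $-$ comes before $+$. Then $N$ is even, and for each $j = 1, \ldots, N/2$ the chord diagrams $\Gamma_{w_{2j-1}}$ and $\Gamma_{w_{2j}}$ are bypass-related. -/

import Mathlib

/-- A chord diagram with `m` chords, up to homotopy relative to endpoints. The `2 * m` marked points
on the boundary circle are numbered `0, 1, …, 2 * m - 1` clockwise, the base point being `0`. The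
diagram is recorded by the map that sends a marked point to the other end of its chord; such a map
comes from disjoint chords exactly when it is a fixed-point-free involution without crossings. -/
@[ext]
structure ChordDiagram (m : ℕ) where
  partner : Fin (2 * m) → Fin (2 * m)
  partner_partner : ∀ i, partner (partner i) = i
  partner_ne : ∀ i, partner i ≠ i
  noncrossing : ∀ a b, ¬ (a < b ∧ b < partner a ∧ partner a < partner b)

namespace ChordDiagram

/-- The six points `p 0, …, p 5` are joined by three chords of `Γ`, namely `p i` is joined to
`p (k - i)` (indices modulo `6`). For `k = 1, 3, 5` these are the three arrangements of three
"parallel" arcs in a hexagon,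
`{(0,1), (2,5), (3,4)}`, `{(0,3), (1,2), (4,5)}`, `{(0,5), (1,4), (2,3)}`,
which are permuted by rotations of the hexagon. -/
def HasArcs {m : ℕ} (Γ : ChordDiagram m) (p : Fin 6 → Fin (2 * m)) (k : Fin 6) : Prop :=
  ∀ i, Γ.partner (p i) = p (k - i)

/-- `Γ` and `Γ'` have the same chords away from the points `p 0, …, p 5`. -/
def AgreeOff {m : ℕ} (Γ Γ' : ChordDiagram m) (p : Fin 6 → Fin (2 * m)) : Prop :=
  ∀ x, x ∉ Set.range p → Γ.partner x = Γ'.partner x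

/-- `Γ'` is obtained from `Γ` by a bypass move (upwards or downwards): a sub-disc in which `Γ`
consists of three parallel arcs (a neighbourhood of an attaching arc) is removed, and glued back
in after a rotation by `60` degrees in one of the two directions. The three arcs lie on three
distinct chords, with the six ends `p 0 < ⋯ < p 5`. That the three chords can be met by one arc that
crosses nothing else need not be required separately: if another chord separated them, then the
surgered chords would cross it. Surgery along an arc which meets fewer than three
distinct chords leaves the diagram unchanged or produces a closed loop, so it never relates
two distinct chord diagrams. -/
def BypassRelated {m : ℕ} (Γ Γ' : ChordDiagram m) : Prop :=
  ∃ p : Fin 6 → Fin (2 * m), StrictMono p ∧ AgreeOff Γ Γ' p ∧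
    ∃ k ∈ ({1, 3, 5} : Set (Fin 6)), ∃ l ∈ ({1, 3, 5} : Set (Fin 6)), k ≠ l ∧
      HasArcs Γ p k ∧ HasArcs Γ' p l

/-- Three chord diagrams that are identical except in a sub-disc, where they consist of the
three different arrangements of three parallel arcs. -/
def BypassTriple {m : ℕ} (Γ₁ Γ₂ Γ₃ : ChordDiagram m) : Prop :=
  ∃ p : Fin 6 → Fin (2 * m), StrictMono p ∧ AgreeOff Γ₁ Γ₂ p ∧ AgreeOff Γ₁ Γ₃ p ∧
    HasArcs Γ₁ p 1 ∧ HasArcs Γ₂ p 3 ∧ HasArcs Γ₃ p 5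

/-- The diagram with one chord. -/
def vacuum : ChordDiagram 1 where
  partner i := 1 - i
  partner_partner := by decide
  partner_ne := by decide
  noncrossing := by decide

/-- The creation operation `B₊`: a new outermost chord `(0, 1)` is added immediately clockwise
of the base point, which is its first end; the old diagram occupies the points `2, 3, …`, its base
point becoming the point `2`. -/
def createPlus {m : ℕ} (Γ : ChordDiagram m) : ChordDiagram (m + 1) where
  partner i :=
    if h0 : i.val = 0 then ⟨1, by omega⟩
    else if h1 : i.val = 1 then ⟨0, by omega⟩
    else ⟨(Γ.partner ⟨i.val - 2, by omega⟩).val + 2, by omega⟩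
  partner_partner i := by
    rcases i with ⟨i, hi⟩
    have := Γ.partner_partner
    apply Fin.ext
    grind
  partner_ne i := by
    rcases i with ⟨i, hi⟩
    have hne : ∀ j, (Γ.partner j).val ≠ j.val := fun j hj => Γ.partner_ne j (Fin.ext hj)
    rw [Ne, Fin.ext_iff]
    by_cases h0 : i = 0
    · simp [h0]
    · by_cases h1 : i = 1
      · simp [h1]
      · have := hne ⟨i - 2, by omega⟩
        simp only [h0, h1, dite_false]
        simp only at this
        omega
  noncrossing a b := by
    rcases a with ⟨a, ha⟩
    rcases b with ⟨b, hb⟩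
    rintro ⟨h1, h2, h3⟩
    simp only [Fin.lt_def] at h1 h2 h3
    have hab : 2 ≤ a ∧ 2 ≤ b := by
      split_ifs at h2 h3 <;> simp only at h2 h3 <;> omega
    have key := Γ.noncrossing ⟨a - 2, by omega⟩ ⟨b - 2, by omega⟩
    simp only [Fin.lt_def] at key
    split_ifs at h2 h3 <;> simp only at h2 h3 <;> omega

/-- The creation operation `B₋`: a new outermost chord is added immediately anticlockwise of the
base point, joining it to the point `-1 = 2 * m + 1`; the base point of the old diagram becomes
the point `-2 = 2 * m`, and its points `1, …, 2 * m - 1` keep their numbers. -/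
def createMinus {m : ℕ} (Γ : ChordDiagram m) : ChordDiagram (m + 1) where
  partner i :=
    if h0 : i.val = 0 then ⟨2 * m + 1, by omega⟩
    else if h1 : i.val = 2 * m + 1 then ⟨0, by omega⟩
    else
      let j := Γ.partner ⟨if i.val = 2 * m then 0 else i.val, by split_ifs <;> omega⟩
      ⟨if j.val = 0 then 2 * m else j.val, by split_ifs <;> omega⟩
  partner_partner i := by
    rcases i with ⟨i, hi⟩
    have := Γ.partner_partner
    apply Fin.ext
    grind
  partner_ne i := by
    rcases i with ⟨i, hi⟩
    have := Γ.partner_ne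
    grind
  noncrossing a b := by
    rcases a with ⟨a, ha⟩
    rcases b with ⟨b, hb⟩
    rintro ⟨h1, h2, h3⟩
    simp only [Fin.lt_def] at h1 h2 h3
    simp only [apply_dite Fin.val] at h2 h3
    have hlt : ∀ j, (Γ.partner j).val < 2 * m := fun j => (Γ.partner j).isLt
    have hab : 0 < a ∧ a < 2 * m ∧ 0 < b ∧ b < 2 * m := by
      refine ⟨?_, ?_, ?_, ?_⟩ <;> grind
    obtain ⟨ha0, ha1, hb0, hb1⟩ := hab
    have key := Γ.noncrossing ⟨a, ha1⟩ ⟨b, hb1⟩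
    have key' := Γ.noncrossing ⟨0, by omega⟩ ⟨a, ha1⟩
    have hpb : (Γ.partner ⟨b, hb1⟩).val = 0 → Γ.partner ⟨0, by omega⟩ = ⟨b, hb1⟩ := by
      intro hb2
      rw [← Γ.partner_partner ⟨b, hb1⟩]
      congr 1
      exact Fin.ext hb2.symm
    simp only [Fin.lt_def] at key key'
    have a0 : ¬ a = 0 := by omega
    have b0 : ¬ b = 0 := by omega
    have a1 : ¬ a = 2 * m + 1 := by omega
    have b1 : ¬ b = 2 * m + 1 := by omega
    have a2 : ¬ a = 2 * m := by omega
    have b2 : ¬ b = 2 * m := by omega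
    simp only [dif_neg a0, dif_neg b0, dif_neg a1, dif_neg b1, if_neg a2, if_neg b2] at h2 h3
    have hlb := hlt ⟨b, hb1⟩
    by_cases ha2 : (Γ.partner ⟨a, ha1⟩).val = 0
    · rw [if_pos ha2] at h3
      by_cases hb2 : (Γ.partner ⟨b, hb1⟩).val = 0
      · rw [if_pos hb2] at h3
        omega
      · rw [if_neg hb2] at h3
        omega
    · rw [if_neg ha2] at h2 h3
      by_cases hb2 : (Γ.partner ⟨b, hb1⟩).val = 0
      · simp only [hpb hb2] at key'
        omega
      · rw [if_neg hb2] at h3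
        omega

/-- The basis chord diagram `Γ_w = B_{w 0} (B_{w 1} (⋯ vacuum))` of a word `w` of length `n` in the
symbols `- = false` and `+ = true`. -/
def ofWord : (n : ℕ) → (Fin n → Bool) → ChordDiagram (n + 1)
  | 0, _ => vacuum
  | n + 1, w =>
    if w 0 then createPlus (ofWord n (Fin.tail w)) else createMinus (ofWord n (Fin.tail w))

end ChordDiagram

/-- The subspace spanned by the bypass relations. (Bypass moves along arcs that meet fewer than
three distinct chords only give the relations `x + x + 0 = 0`, which hold over `ZMod 2`.) -/
noncomputable def bypassRelations (m : ℕ) : Submodule (ZMod 2) (ChordDiagram m →₀ ZMod 2) :=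
  Submodule.span (ZMod 2)
    {x | ∃ Γ₁ Γ₂ Γ₃ : ChordDiagram m, ChordDiagram.BypassTriple Γ₁ Γ₂ Γ₃ ∧
      x = Finsupp.single Γ₁ 1 + Finsupp.single Γ₂ 1 + Finsupp.single Γ₃ 1}

/-- Combinatorial `SFH(T, m)`: the `ZMod 2`-vector space generated by the chord diagrams with `m`
chords, modulo the bypass relations. -/
abbrev SFHcomb (m : ℕ) : Type :=
  (ChordDiagram m →₀ ZMod 2) ⧸ bypassRelations m

/-- The element of `SFHcomb m` represented by a chord diagram. -/
noncomputable def ChordDiagram.toSFH {m : ℕ} (Γ : ChordDiagram m) : SFHcomb m :=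
  Submodule.Quotient.mk (Finsupp.single Γ 1)

/-! Write B₊, B₋ for `createPlus`, `createMinus`. The proof has two independent halves.

Spanning and pairing come from one induction on `n` (`exists_isDecomposition`). If the chord at the
base point is outermost, then Γ = B₊Γ' or B₋Γ', and these operations carry a paired decomposition of
Γ' to one of Γ. Otherwise surgery on the chords at the base point and its two neighbours puts Γ in a
bypass triple with some B₊Γ₁ and B₋Γ₂, so Γ = B₋Γ₂ + B₊Γ₁ in the quotient. The crux is
`exists_ofWord_iff_exists_ofWord`: Γ₁ is a basis diagram if and only if Γ₂ is. If both are, Γ is a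
sum of two basis elements, related because they lie in one triple. If neither is, the two inductive
decompositions are concatenated: words starting with − precede those starting with +, so pairs stay
adjacent.

Linear independence comes from a determinant. The boundary intervals [2i, 2i+1] border the regions
of one colour, and `space` Γ is the subspace that identifies intervals in the same region. The three
spaces of a bypass triple have the form U + ⟨u₁⟩, U + ⟨u₂⟩, U + ⟨u₃⟩ with u₁ + u₂ + u₃ ∈ U. Hence,
for a fixed subspace C, the mod 2 indicator of being complementary to C, which behaves like a
determinant, respects the bypass relations (`sum_isCompl_space_eq_zero`). The subspaces `dualSpace`
are chosen so that these functionals are dual to the basis diagrams (`isCompl_space_dualSpace_iff`).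
-/

namespace ChordDiagram

/-! ### Diagrams as involutions of ℕ, and the sectors cut out by a bypass hexagon. -/

/-- The map `Γ.partner` on natural numbers, extended by the identity. -/
def mate {m : ℕ} (Γ : ChordDiagram m) (x : ℕ) : ℕ :=
  if h : x < 2 * m then (Γ.partner ⟨x, h⟩).val else x

section Mate

variable {m : ℕ} (Γ : ChordDiagram m)

theorem mate_val (x : Fin (2 * m)) : Γ.mate x = Γ.partner x := by
  simp [mate]

theorem mate_of_le {x : ℕ} (h : 2 * m ≤ x) : Γ.mate x = x := by
  simp [mate, h]

theorem mate_lt {x : ℕ} (h : x < 2 * m) : Γ.mate x < 2 * m := by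
  simp [mate, h]

theorem mate_mate (x : ℕ) : Γ.mate (Γ.mate x) = x := by
  by_cases h : x < 2 * m
  · have h1 : Γ.mate x = Γ.partner ⟨x, h⟩ := Γ.mate_val ⟨x, h⟩
    rw [h1, mate_val, partner_partner]
  · rw [Γ.mate_of_le (not_lt.1 h), Γ.mate_of_le (not_lt.1 h)]

theorem mate_eq_comm {x y : ℕ} : Γ.mate x = y ↔ Γ.mate y = x :=
  ⟨fun h => by rw [← h, mate_mate], fun h => by rw [← h, mate_mate]⟩

theorem mate_ne {x : ℕ} (h : x < 2 * m) : Γ.mate x ≠ x := by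
  rw [show Γ.mate x = Γ.partner ⟨x, h⟩ from Γ.mate_val ⟨x, h⟩]
  exact fun h' => Γ.partner_ne _ (Fin.ext h')

theorem mate_noncrossing {a b : ℕ} (h1 : a < b) (h2 : b < Γ.mate a) (h3 : Γ.mate a < Γ.mate b) :
    False := by
  have ha : a < 2 * m := by
    by_contra h
    rw [Γ.mate_of_le (not_lt.1 h)] at h2
    omega
  have hb : b < 2 * m := h2.trans (Γ.mate_lt ha)
  refine Γ.noncrossing ⟨a, ha⟩ ⟨b, hb⟩ ⟨h1, ?_, ?_⟩
  · rw [Fin.lt_def, ← mate_val]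
    exact h2
  · rw [Fin.lt_def, ← mate_val, ← mate_val]
    exact h3

variable {Γ} in
theorem ext_mate {Γ' : ChordDiagram m} (h : ∀ x < 2 * m, Γ.mate x = Γ'.mate x) : Γ = Γ' := by
  ext x
  rw [← mate_val, ← mate_val]
  exact h x x.2

/-- A chord diagram from a map on natural numbers. -/
def ofMate (f : ℕ → ℕ) (hlt : ∀ x < 2 * m, f x < 2 * m) (hinv : ∀ x < 2 * m, f (f x) = x)
    (hne : ∀ x < 2 * m, f x ≠ x)
    (hnc : ∀ a < 2 * m, ∀ b < 2 * m, a < b → b < f a → f a < f b → False) : ChordDiagram m where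
  partner x := ⟨f x, hlt x x.2⟩
  partner_partner x := Fin.ext (hinv x x.2)
  partner_ne x h := hne x x.2 (congrArg Fin.val h)
  noncrossing a b h := hnc a a.2 b b.2 h.1 h.2.1 h.2.2

theorem mate_ofMate {f : ℕ → ℕ} {hlt : ∀ x < 2 * m, f x < 2 * m}
    {hinv : ∀ x < 2 * m, f (f x) = x} {hne : ∀ x < 2 * m, f x ≠ x}
    {hnc : ∀ a < 2 * m, ∀ b < 2 * m, a < b → b < f a → f a < f b → False} {x : ℕ}
    (hx : x < 2 * m) : (ofMate f hlt hinv hne hnc).mate x = f x :=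
  mate_val (ofMate f hlt hinv hne hnc) ⟨x, hx⟩

theorem sum_closed_eq_zero {A : Type*} [AddCommMonoid A] {S : Finset ℕ}
    (hlt : ∀ x ∈ S, x < 2 * m) (hS : ∀ x ∈ S, Γ.mate x ∈ S) {F : ℕ → A}
    (hF : ∀ x ∈ S, F x + F (Γ.mate x) = 0) : ∑ x ∈ S, F x = 0 :=
  Finset.sum_involution (fun x _ => Γ.mate x) hF (fun x hx _ => Γ.mate_ne (hlt x hx)) hS
    (fun x _ => Γ.mate_mate x)

theorem even_card_of_closed {S : Finset ℕ} (hlt : ∀ x ∈ S, x < 2 * m)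
    (hS : ∀ x ∈ S, Γ.mate x ∈ S) : Even S.card := by
  have h := Γ.sum_closed_eq_zero (A := ZMod 2) hlt hS (F := fun _ => 1) (fun _ _ => by decide)
  rw [Finset.sum_const, nsmul_one, ZMod.natCast_eq_zero_iff] at h
  exact even_iff_two_dvd.2 h

variable {Γ}

theorem hasArcs_iff {p : Fin 6 → Fin (2 * m)} {k : Fin 6} :
    HasArcs Γ p k ↔ ∀ i, Γ.mate (p i) = p (k - i) := by
  simp only [HasArcs, mate_val, Fin.ext_iff]

theorem agreeOff_iff {Γ' : ChordDiagram m} {p : Fin 6 → Fin (2 * m)} :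
    AgreeOff Γ Γ' p ↔ ∀ x : ℕ, (∀ i, x ≠ p i) → Γ.mate x = Γ'.mate x := by
  constructor
  · intro h x hx
    by_cases hx' : x < 2 * m
    · rw [show Γ.mate x = Γ.partner ⟨x, hx'⟩ from Γ.mate_val ⟨x, hx'⟩,
        show Γ'.mate x = Γ'.partner ⟨x, hx'⟩ from Γ'.mate_val ⟨x, hx'⟩, h]
      rintro ⟨i, hi⟩
      exact hx i (by rw [hi])
    · rw [mate_of_le _ (not_lt.1 hx'), mate_of_le _ (not_lt.1 hx')]
  · intro h x hx
    apply Fin.ext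
    rw [← mate_val, ← mate_val]
    exact h x (fun i hi => hx ⟨i, (Fin.ext hi).symm⟩)

theorem HasArcs.mate_ne_point {p : Fin 6 → Fin (2 * m)} {k : Fin 6} (h : HasArcs Γ p k) {x : ℕ}
    (hx : ∀ i, x ≠ p i) (i : Fin 6) : Γ.mate x ≠ p i := by
  intro hi
  rw [hasArcs_iff] at h
  rw [mate_eq_comm, h] at hi
  exact hx _ hi.symm

/-- A chord passing over one end of an arc but not over the other would cross that arc. -/
theorem HasArcs.inside {p : Fin 6 → Fin (2 * m)} {k : Fin 6} (h : HasArcs Γ p k) {x : ℕ}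
    (hx : ∀ i, x ≠ p i) {j : Fin 6} (hj : x < p j ∧ p j < Γ.mate x) :
    x < p (k - j) ∧ p (k - j) < Γ.mate x := by
  have h1 := hx (k - j)
  have h2 := h.mate_ne_point hx (k - j)
  rw [hasArcs_iff] at h
  have e1 := h j
  have e2 : Γ.mate (p (k - j)) = p j := by rw [mate_eq_comm, e1]
  constructor
  · by_contra h3
    exact Γ.mate_noncrossing (a := p (k - j)) (b := x) (by omega) (by omega) (by omega)
  · by_contra h3
    exact Γ.mate_noncrossing (a := x) (b := p j) (by omega) (by omega) (by omega)

end Mate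

/-- The reflections attached to the three arrangements act transitively on the six points. -/
theorem forall_of_reflections {P : Fin 6 → Prop} (h1 : ∀ j, P j → P (1 - j))
    (h3 : ∀ j, P j → P (3 - j)) (h5 : ∀ j, P j → P (5 - j)) {i : Fin 6} (hi : P i) (j : Fin 6) :
    P j := by
  have cases : ∀ i j : Fin 6, j = i ∨ j = 3 - (1 - i) ∨ j = 5 - (1 - i) ∨ j = 1 - i ∨
      j = 3 - i ∨ j = 5 - i := by decide
  rcases cases i j with h | h | h | h | h | h <;> subst h
  exacts [hi, h3 _ (h1 _ hi), h5 _ (h1 _ hi), h1 _ hi, h3 _ hi, h5 _ hi]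

section Triple

variable {m : ℕ} {Γ₁ Γ₂ Γ₃ : ChordDiagram m} {p : Fin 6 → Fin (2 * m)}

/-- A chord away from `p` belongs to all three diagrams. If it passes over one of the six points, it
passes over that point's partner in each arrangement, hence over all six. So it cannot leave the
range between `p i` and `p j`. -/
theorem mate_mem_sector (a2 : AgreeOff Γ₁ Γ₂ p) (a3 : AgreeOff Γ₁ Γ₃ p) (h1 : HasArcs Γ₁ p 1)
    (h2 : HasArcs Γ₂ p 3) (h3 : HasArcs Γ₃ p 5) {x : ℕ} {i j : Fin 6} (hi : p i < x)
    (hj : x < p j) (hx : ∀ i, x ≠ p i) : p i < Γ₁.mate x ∧ Γ₁.mate x < p j := by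
  rw [agreeOff_iff] at a2 a3
  have key : ∀ x : ℕ, (∀ i, x ≠ p i) → ∀ i j, (x < p i ∧ p i < Γ₁.mate x) →
      (x < p j ∧ p j < Γ₁.mate x) := by
    intro x hx i j hi
    refine forall_of_reflections (P := fun j => x < p j ∧ p j < Γ₁.mate x) ?_ ?_ ?_ hi j
    · exact fun j hj => h1.inside hx hj
    · intro j hj
      rw [a2 x hx] at hj ⊢
      exact h2.inside hx hj
    · intro j hj
      rw [a3 x hx] at hj ⊢
      exact h3.inside hx hj
  have hy := h1.mate_ne_point hx
  have k1 := key x hx j i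
  have k2 := key _ hy i j
  rw [mate_mate] at k2
  have := hy i
  have := hy j
  omega

end Triple

end ChordDiagram

/-! ### The region space of a diagram, and how the hexagon enters it. -/

namespace ChordDiagram

/-- The generator of the interval between the boundary points `2 * i` and `2 * i + 1` which has
`x` as an end. -/
noncomputable def intervalVec (x : ℕ) : ℕ →₀ ZMod 2 :=
  Finsupp.single (x / 2) 1

/-- The span of the sums of the two boundary intervals joined by a chord. -/
noncomputable def space {m : ℕ} (Γ : ChordDiagram m) : Submodule (ZMod 2) (ℕ →₀ ZMod 2) :=
  Submodule.span (ZMod 2) (Set.range fun x => intervalVec x + intervalVec (Γ.mate x))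

/-- The span of the sums of the two boundary intervals joined by a chord away from `p`. -/
noncomputable def spaceOff {m : ℕ} (Γ : ChordDiagram m) (p : Fin 6 → Fin (2 * m)) :
    Submodule (ZMod 2) (ℕ →₀ ZMod 2) :=
  Submodule.span (ZMod 2)
    ((fun x => intervalVec x + intervalVec (Γ.mate x)) '' {x | ∀ i, x ≠ p i})

theorem sum_Ico_half_eq_zero {A : Type*} [AddCommMonoid A] {F : ℕ → A}
    (h2 : ∀ y, F (2 * y) + F (2 * y + 1) = 0) (a b : ℕ) :
    ∑ x ∈ Finset.Ico (2 * a) (2 * b), F x = 0 := by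
  induction b with
  | zero => simp
  | succ b ih =>
    by_cases h : a ≤ b
    · rw [show 2 * (b + 1) = 2 * b + 1 + 1 by ring, Finset.sum_Ico_succ_top (by omega),
        Finset.sum_Ico_succ_top (by omega), ih, zero_add, h2]
    · rw [Finset.Ico_eq_empty (by omega), Finset.sum_empty]

section Triple

variable {m : ℕ} {Γ₁ Γ₂ Γ₃ : ChordDiagram m} {p : Fin 6 → Fin (2 * m)}

/-- The three arcs of an arrangement together contribute a single new vector `u` beyond the common
part `spaceOff`. -/
theorem space_eq_sup {Γ : ChordDiagram m} {k : Fin 6} (h : HasArcs Γ p k)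
    (ha : AgreeOff Γ₁ Γ p) {u : ℕ →₀ ZMod 2} (i : Fin 6)
    (hu : u = intervalVec (p i) + intervalVec (p (k - i)))
    (h' : ∀ i, intervalVec (p i) + intervalVec (p (k - i)) ∈
      spaceOff Γ₁ p ⊔ Submodule.span (ZMod 2) {u}) :
    Γ.space = spaceOff Γ₁ p ⊔ Submodule.span (ZMod 2) {u} := by
  rw [agreeOff_iff] at ha
  rw [hasArcs_iff] at h
  apply le_antisymm
  · rw [space, Submodule.span_le]
    rintro _ ⟨x, rfl⟩
    by_cases hx : ∀ i, x ≠ p i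
    · refine Submodule.mem_sup_left (Submodule.subset_span ⟨x, hx, ?_⟩)
      simp only [ha x hx]
    · push Not at hx
      obtain ⟨i, rfl⟩ := hx
      simp only [h]
      exact h' i
  · refine sup_le (Submodule.span_mono ?_) ?_
    · rintro _ ⟨x, hx, rfl⟩
      exact ⟨x, by simp only [ha x hx]⟩
    · rw [Submodule.span_singleton_le_iff_mem]
      exact Submodule.subset_span ⟨p i, by simp only [h, hu]⟩

theorem mkQ_eq_mkQ_iff (D : Submodule (ZMod 2) (ℕ →₀ ZMod 2)) (x y : ℕ →₀ ZMod 2) :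
    D.mkQ x = D.mkQ y ↔ x + y ∈ D := by
  rw [← sub_eq_zero, ← map_sub, ZModModule.sub_eq_add, Submodule.mkQ_apply,
    Submodule.Quotient.mk_eq_zero]

theorem mkQ_intervalVec_mate {x : ℕ} (hx : ∀ i, x ≠ p i) :
    (spaceOff Γ₁ p).mkQ (intervalVec x) + (spaceOff Γ₁ p).mkQ (intervalVec (Γ₁.mate x)) = 0 := by
  rw [← map_add, Submodule.mkQ_apply, Submodule.Quotient.mk_eq_zero]
  exact Submodule.subset_span ⟨x, hx, rfl⟩

theorem mkQ_intervalVec_pair (D : Submodule (ZMod 2) (ℕ →₀ ZMod 2)) (y : ℕ) :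
    D.mkQ (intervalVec (2 * y)) + D.mkQ (intervalVec (2 * y + 1)) = 0 := by
  rw [show intervalVec (2 * y + 1) = intervalVec (2 * y) by
    unfold intervalVec; congr 1; omega]
  exact ZModModule.add_self _

/-- Sum the interval classes over all points from `p i` to `p j`. The points 2y and 2y+1 cancel
because they share an interval, and the points strictly between cancel along chords of the sector;
so the two ends have equal classes. -/
theorem mkQ_side (a2 : AgreeOff Γ₁ Γ₂ p) (a3 : AgreeOff Γ₁ Γ₃ p) (h1 : HasArcs Γ₁ p 1)
    (h2 : HasArcs Γ₂ p 3) (h3 : HasArcs Γ₃ p 5) {i j : Fin 6} (hij : p i < p j)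
    (hb : ∀ x : ℕ, p i < x → x < p j → ∀ l, x ≠ p l) (hi : Even (p i : ℕ))
    (hj : Odd (p j : ℕ)) :
    (spaceOff Γ₁ p).mkQ (intervalVec (p i)) = (spaceOff Γ₁ p).mkQ (intervalVec (p j)) := by
  obtain ⟨a, ha⟩ := even_iff_exists_two_mul.1 hi
  obtain ⟨b, hb'⟩ := hj
  have e1 := sum_Ico_half_eq_zero
    (F := fun x => (spaceOff Γ₁ p).mkQ (intervalVec x)) (mkQ_intervalVec_pair (spaceOff Γ₁ p)) a (b + 1)
  have hij' : (p i : ℕ) < p j := hij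
  rw [← ha, show 2 * (b + 1) = (p j : ℕ) + 1 by omega, Finset.sum_Ico_succ_top (by omega),
    Finset.sum_eq_sum_Ico_succ_bot (by omega)] at e1
  rw [Γ₁.sum_closed_eq_zero (S := Finset.Ico (p i + 1 : ℕ) (p j))] at e1
  · rw [add_zero, ← ZModModule.sub_eq_add, sub_eq_zero] at e1
    exact e1
  · intro x hx
    rw [Finset.mem_Ico] at hx
    have := (p j).2
    omega
  · intro x hx
    rw [Finset.mem_Ico] at hx ⊢
    exact mate_mem_sector a2 a3 h1 h2 h3 hx.1 hx.2 (hb x hx.1 hx.2)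
  · intro x hx
    rw [Finset.mem_Ico] at hx
    exact mkQ_intervalVec_mate (hb x hx.1 hx.2)

/-- The same double cancellation for the sector through the base point, which consists of the points
before `p 0` and after `p 5`. -/
theorem mkQ_outer_side (a2 : AgreeOff Γ₁ Γ₂ p) (a3 : AgreeOff Γ₁ Γ₃ p) (h1 : HasArcs Γ₁ p 1)
    (h2 : HasArcs Γ₂ p 3) (h3 : HasArcs Γ₃ p 5) (hp : StrictMono p) (h0 : Odd (p 0 : ℕ))
    (h5 : Even (p 5 : ℕ)) :
    (spaceOff Γ₁ p).mkQ (intervalVec (p 0)) = (spaceOff Γ₁ p).mkQ (intervalVec (p 5)) := by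
  obtain ⟨a, ha⟩ := h0
  obtain ⟨b, hb⟩ := even_iff_exists_two_mul.1 h5
  have hp0 : ∀ l, (p 0 : ℕ) ≤ p l := fun l => hp.monotone (Fin.zero_le l)
  have hp5 : ∀ l, (p l : ℕ) ≤ p 5 := fun l => hp.monotone (Fin.le_last l)
  have e1 := sum_Ico_half_eq_zero
    (F := fun x => (spaceOff Γ₁ p).mkQ (intervalVec x)) (mkQ_intervalVec_pair (spaceOff Γ₁ p)) 0 (a + 1)
  have e2 := sum_Ico_half_eq_zero
    (F := fun x => (spaceOff Γ₁ p).mkQ (intervalVec x)) (mkQ_intervalVec_pair (spaceOff Γ₁ p)) b m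
  rw [show 2 * (a + 1) = (p 0 : ℕ) + 1 by omega, Finset.sum_Ico_succ_top (by omega)] at e1
  rw [← hb, Finset.sum_eq_sum_Ico_succ_bot (p 5).2] at e2
  have e3 := Γ₁.sum_closed_eq_zero
    (S := Finset.Ico (2 * 0) (p 0 : ℕ) ∪ Finset.Ico (p 5 + 1 : ℕ) (2 * m))
    (F := fun x => (spaceOff Γ₁ p).mkQ (intervalVec x)) ?_ ?_ ?_
  · rw [Finset.sum_union] at e3
    · have e4 : (spaceOff Γ₁ p).mkQ (intervalVec (p 0)) +
          (spaceOff Γ₁ p).mkQ (intervalVec (p 5)) = 0 := by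
        have := congrArg₂ (· + ·) e1 e2
        simp only [add_zero] at this
        rw [← this, ← add_zero (_ + _), ← e3]
        abel
      rw [← ZModModule.sub_eq_add, sub_eq_zero] at e4
      exact e4
    · rw [Finset.disjoint_left]
      intro x hx hx'
      rw [Finset.mem_Ico] at hx hx'
      have := hp5 0
      omega
  · intro x hx
    rw [Finset.mem_union, Finset.mem_Ico, Finset.mem_Ico] at hx
    have := (p 0).2
    omega
  · intro x hx
    rw [Finset.mem_union, Finset.mem_Ico, Finset.mem_Ico] at hx ⊢
    have hxl : x < 2 * m := by
      have := (p 0).2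
      omega
    have hx' : ∀ l, x ≠ p l := by
      intro l
      have := hp0 l
      have := hp5 l
      omega
    have hy := h1.mate_ne_point hx'
    have k := mate_mem_sector a2 a3 h1 h2 h3 (x := Γ₁.mate x) (i := 0) (j := 5)
    rw [mate_mate] at k
    have := hy 0
    have := hy 5
    have := Γ₁.mate_lt hxl
    by_contra hcon
    have := k (by omega) (by omega) hy
    omega
  · intro x hx
    rw [Finset.mem_union, Finset.mem_Ico, Finset.mem_Ico] at hx
    apply mkQ_intervalVec_mate
    intro l
    have := hp0 l
    have := hp5 l
    omega

/-- The functional counts, mod 2, the intervals from `p i` to `p j`; it kills `spaceOff` because a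
chord away from `p` has both ends in this range or neither. It serves to certify that arc vectors
lie outside `spaceOff`. -/
theorem exists_side_functional (a2 : AgreeOff Γ₁ Γ₂ p) (a3 : AgreeOff Γ₁ Γ₃ p)
    (h1 : HasArcs Γ₁ p 1) (h2 : HasArcs Γ₂ p 3) (h3 : HasArcs Γ₃ p 5) (hp : StrictMono p)
    {i j : Fin 6} (hi : Even (p i : ℕ)) (hj : Odd (p j : ℕ)) :
    ∃ l : (ℕ →₀ ZMod 2) →ₗ[ZMod 2] ZMod 2, (∀ x ∈ spaceOff Γ₁ p, l x = 0) ∧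
      ∀ s, l (intervalVec (p s)) = if i ≤ s ∧ s ≤ j then 1 else 0 := by
  obtain ⟨a, ha⟩ := even_iff_exists_two_mul.1 hi
  obtain ⟨b, hb⟩ := hj
  let l := Finsupp.linearCombination (ZMod 2) fun y : ℕ => if a ≤ y ∧ y ≤ b then (1 : ZMod 2) else 0
  have hl : ∀ x, l (intervalVec x) = if (p i : ℕ) ≤ x ∧ x ≤ p j then 1 else 0 := by
    intro x
    simp only [l, intervalVec, Finsupp.linearCombination_single, one_smul]
    congr 1
    apply propext
    omega
  refine ⟨l, fun x hx => ?_, fun s => ?_⟩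
  · rw [← LinearMap.mem_ker]
    refine (Submodule.span_le.2 ?_ : spaceOff Γ₁ p ≤ LinearMap.ker l) hx
    rintro _ ⟨x, hx, rfl⟩
    have hy := h1.mate_ne_point hx
    have k1 := fun h h' => mate_mem_sector a2 a3 h1 h2 h3 (i := i) (j := j) h h' hx
    have k2 := fun h h' => mate_mem_sector a2 a3 h1 h2 h3 (i := i) (j := j) h h' hy
    rw [mate_mate] at k2
    have := hx i
    have := hx j
    have := hy i
    have := hy j
    simp only [SetLike.mem_coe, LinearMap.mem_ker, map_add, hl]
    have : ((p i : ℕ) ≤ x ∧ x ≤ p j) ↔ ((p i : ℕ) ≤ Γ₁.mate x ∧ Γ₁.mate x ≤ p j) := by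
      constructor
      · intro h
        have := k1 (by omega) (by omega)
        omega
      · intro h
        have := k2 (by omega) (by omega)
        omega
    simp only [this]
    exact ZModModule.add_self _
  · rw [hl]
    simp only [Fin.val_fin_le, hp.le_iff_le]

theorem even_iff_odd_of_consecutive (a2 : AgreeOff Γ₁ Γ₂ p) (a3 : AgreeOff Γ₁ Γ₃ p) (h1 : HasArcs Γ₁ p 1)
    (h2 : HasArcs Γ₂ p 3) (h3 : HasArcs Γ₃ p 5) {i j : Fin 6} (hij : p i < p j)
    (hb : ∀ x : ℕ, p i < x → x < p j → ∀ l, x ≠ p l) : Even (p i : ℕ) ↔ Odd (p j : ℕ) := by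
  have h := Γ₁.even_card_of_closed (S := Finset.Ico (p i + 1 : ℕ) (p j)) ?_ ?_
  · rw [Nat.card_Ico] at h
    have hij' : (p i : ℕ) < p j := hij
    grind
  · intro x hx
    rw [Finset.mem_Ico] at hx
    have := (p j).2
    omega
  · intro x hx
    rw [Finset.mem_Ico] at hx ⊢
    exact mate_mem_sector a2 a3 h1 h2 h3 hx.1 hx.2 (hb x hx.1 hx.2)

end Triple

end ChordDiagram

/-! ### Linear algebra over 𝔽₂: complements of three subspaces on a line. -/

section LinearAlgebra

variable {V : Type*} [AddCommGroup V] [Module (ZMod 2) V]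

theorem mem_sup_span_singleton_iff {U : Submodule (ZMod 2) V} {u x : V} :
    x ∈ U ⊔ Submodule.span (ZMod 2) {u} ↔ x ∈ U ∨ x + u ∈ U := by
  rw [Submodule.mem_sup]
  constructor
  · rintro ⟨y, hy, z, hz, rfl⟩
    obtain ⟨c, rfl⟩ := Submodule.mem_span_singleton.1 hz
    rcases (by decide : ∀ c : ZMod 2, c = 0 ∨ c = 1) c with rfl | rfl
    · left
      simpa using hy
    · right
      simpa [add_assoc, ZModModule.add_self] using hy
  · rintro (h | h)
    · exact ⟨x, h, 0, zero_mem _, add_zero x⟩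
    · exact ⟨x + u, h, u, Submodule.mem_span_singleton_self u, by
        rw [add_assoc, ZModModule.add_self, add_zero]⟩

theorem isCompl_sup_span_singleton_iff {U C : Submodule (ZMod 2) V} {u : V} (hu : u ∉ U) :
    IsCompl (U ⊔ Submodule.span (ZMod 2) {u}) C ↔
      Disjoint U C ∧ u ∉ U ⊔ C ∧ ∀ v, v ∈ U ⊔ C ∨ v + u ∈ U ⊔ C := by
  have h1 : Codisjoint (U ⊔ Submodule.span (ZMod 2) {u}) C ↔
      ∀ v, v ∈ U ⊔ C ∨ v + u ∈ U ⊔ C := by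
    rw [codisjoint_iff, sup_right_comm, Submodule.eq_top_iff']
    simp only [mem_sup_span_singleton_iff]
  have h2 : Disjoint (U ⊔ Submodule.span (ZMod 2) {u}) C ↔ Disjoint U C ∧ u ∉ U ⊔ C := by
    constructor
    · intro h
      refine ⟨h.mono_left le_sup_left, fun hmem => hu ?_⟩
      obtain ⟨a, ha, c, hc, hac⟩ := Submodule.mem_sup.1 hmem
      have hc' : c ∈ U ⊔ Submodule.span (ZMod 2) {u} := by
        rw [mem_sup_span_singleton_iff]
        right
        rwa [← hac, add_comm, add_assoc, ZModModule.add_self, add_zero]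
      rwa [← hac, Submodule.disjoint_def.1 h c hc' hc, add_zero]
    · rintro ⟨h, hD⟩
      rw [Submodule.disjoint_def]
      intro x hx hxC
      rcases mem_sup_span_singleton_iff.1 hx with hx | hx
      · exact Submodule.disjoint_def.1 h x hx hxC
      · refine absurd (Submodule.mem_sup.2 ⟨_, hx, x, hxC, ?_⟩) hD
        rw [add_comm, ← add_assoc, ZModModule.add_self, zero_add]
  rw [isCompl_iff, h1, h2, and_assoc]

-- The indicator is a determinant mod 2, linear in `u`. Concretely, put D = U + C. If one of the
-- vectors lies in D, its indicator is 0 and the other two vectors agree modulo D. If none does, D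
-- cannot have index two, since three vectors of the nonzero coset would not sum into D; so all
-- three indicators are 0.
open Classical in
theorem sum_isCompl_eq_zero {U C : Submodule (ZMod 2) V} {u₁ u₂ u₃ : V} (h₁ : u₁ ∉ U)
    (h₂ : u₂ ∉ U) (h₃ : u₃ ∉ U) (h : u₁ + u₂ + u₃ ∈ U) :
    (if IsCompl (U ⊔ Submodule.span (ZMod 2) {u₁}) C then (1 : ZMod 2) else 0) +
      (if IsCompl (U ⊔ Submodule.span (ZMod 2) {u₂}) C then 1 else 0) +
      (if IsCompl (U ⊔ Submodule.span (ZMod 2) {u₃}) C then 1 else 0) = 0 := by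
  simp only [isCompl_sup_span_singleton_iff h₁, isCompl_sup_span_singleton_iff h₂,
    isCompl_sup_span_singleton_iff h₃]
  by_cases hd : Disjoint U C
  swap
  · simp [hd]
  have hD : u₁ + u₂ + u₃ ∈ U ⊔ C := Submodule.mem_sup_left h
  simp only [hd, true_and]
  generalize U ⊔ C = D at hD
  have aux : ∀ {a b c : V}, a + b + c ∈ D → a ∈ D → (b ∈ D ↔ c ∈ D) := by
    intro a b c habc ha
    have hbc : b + c ∈ D := by
      have := D.sub_mem habc ha
      rwa [add_assoc, add_sub_cancel_left] at this
    exact ⟨fun hb => (Submodule.add_mem_iff_right D hb).1 hbc,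
      fun hc => (Submodule.add_mem_iff_left D hc).1 hbc⟩
  have aux2 : ∀ {a b c : V}, a + b + c ∈ D → a ∈ D →
      ((∀ v, v ∈ D ∨ v + b ∈ D) ↔ (∀ v, v ∈ D ∨ v + c ∈ D)) := by
    intro a b c habc ha
    refine forall_congr' fun v => or_congr_right ?_
    refine aux (a := a) ?_ ha
    rwa [show a + (v + b) + (v + c) = a + b + c + (v + v) by abel, ZModModule.add_self, add_zero]
  have r1 : u₂ + u₁ + u₃ ∈ D := by rwa [add_comm u₂]
  have r2 : u₃ + u₁ + u₂ ∈ D := by rwa [add_assoc, add_comm]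
  have two : ∀ z : ZMod 2, z + z = 0 := by decide
  by_cases m1 : u₁ ∈ D
  · simp [m1, aux hD m1, aux2 hD m1, two]
  by_cases m2 : u₂ ∈ D
  · simp [m2, aux r1 m2, aux2 r1 m2, two]
  by_cases m3 : u₃ ∈ D
  · simp [m3, aux r2 m3, aux2 r2 m3, two]
  have aux3 : ∀ {a b c : V}, a + b + c ∈ D → b ∉ D → c ∉ D → ¬ ∀ v, v ∈ D ∨ v + a ∈ D := by
    intro a b c habc hb hc hv
    rcases hv b with h | h
    · exact hb h
    · rw [add_comm] at h
      exact hc ((Submodule.add_mem_iff_right D h).1 habc)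
  have r3 : u₂ + u₃ + u₁ ∈ D := by rwa [add_comm, ← add_assoc]
  rw [if_neg fun h => aux3 hD m2 m3 h.2, if_neg fun h => aux3 r1 m1 m3 h.2,
    if_neg fun h => aux3 r2 m1 m2 h.2]
  rfl

end LinearAlgebra

/-! ### Complement indicators respect bypass triples. -/

namespace ChordDiagram

section Triple

variable {m : ℕ} {Γ₁ Γ₂ Γ₃ : ChordDiagram m} {p : Fin 6 → Fin (2 * m)}

theorem no_point_between (hp : StrictMono p) {i j : Fin 6} (hij : j.val = i.val + 1) (x : ℕ)
    (h1 : p i < x) (h2 : x < p j) (l : Fin 6) : x ≠ p l := by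
  rintro rfl
  rw [Fin.val_fin_lt, hp.lt_iff_lt] at h1 h2
  omega

theorem space_eq_sup_of_mkQ {Γ : ChordDiagram m} {k : Fin 6} (h : HasArcs Γ p k)
    (ha : AgreeOff Γ₁ Γ p) (i : Fin 6)
    (h' : ∀ D : Submodule (ZMod 2) (ℕ →₀ ZMod 2), spaceOff Γ₁ p ≤ D →
      D.mkQ (intervalVec (p i)) = D.mkQ (intervalVec (p (k - i))) →
      ∀ i, D.mkQ (intervalVec (p i)) = D.mkQ (intervalVec (p (k - i)))) :
    Γ.space = spaceOff Γ₁ p ⊔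
      Submodule.span (ZMod 2) {intervalVec (p i) + intervalVec (p (k - i))} := by
  refine space_eq_sup h ha i rfl fun j => ?_
  rw [← mkQ_eq_mkQ_iff]
  apply h' _ le_sup_left
  rw [mkQ_eq_mkQ_iff]
  exact Submodule.mem_sup_right (Submodule.mem_span_singleton_self _)

theorem mkQ_eq_of_le {U D : Submodule (ZMod 2) (ℕ →₀ ZMod 2)} (h : U ≤ D)
    {x y : ℕ →₀ ZMod 2} (hxy : U.mkQ x = U.mkQ y) : D.mkQ x = D.mkQ y := by
  rw [mkQ_eq_mkQ_iff] at hxy ⊢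
  exact h hxy

theorem eq_zero_of_eq_add_self {A : Type*} [AddCommGroup A] [Module (ZMod 2) A] (x y z : A) {s : A}
    (h : s = (x + x) + (y + y) + (z + z)) : s = 0 := by
  simp only [h, ZModModule.add_self]

theorem forall_fin_six {P : Fin 6 → Prop} (h0 : P 0) (h1 : P 1) (h2 : P 2) (h3 : P 3)
    (h4 : P 4) (h5 : P 5) (i : Fin 6) : P i := by
  fin_cases i <;> assumption

-- The sides of the hexagon alternate in colour, so the six ends give only three classes modulo
-- `spaceOff`, and each arrangement identifies two of them. The three sums of two classes add up to
-- zero.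
open Classical in
theorem sum_isCompl_space_eq_zero (h : BypassTriple Γ₁ Γ₂ Γ₃)
    (C : Submodule (ZMod 2) (ℕ →₀ ZMod 2)) :
    (if IsCompl Γ₁.space C then (1 : ZMod 2) else 0) + (if IsCompl Γ₂.space C then 1 else 0) +
      (if IsCompl Γ₃.space C then 1 else 0) = 0 := by
  obtain ⟨p, hp, a2, a3, h1, h2, h3⟩ := h
  have odd := fun i j (hij : j.val = i.val + 1) => even_iff_odd_of_consecutive a2 a3 h1 h2 h3 (i := i) (j := j)
    (hp (by rw [Fin.lt_def]; omega)) (no_point_between hp hij)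
  have side := fun i j (hij : j.val = i.val + 1) => mkQ_side a2 a3 h1 h2 h3 (i := i) (j := j)
    (hp (by rw [Fin.lt_def]; omega)) (no_point_between hp hij)
  have a1 : AgreeOff Γ₁ Γ₁ p := fun _ _ => rfl
  have o1 := odd 0 1 rfl
  have o2 := odd 1 2 rfl
  have o3 := odd 2 3 rfl
  have o4 := odd 3 4 rfl
  have o5 := odd 4 5 rfl
  have func := fun i j hi hj => exists_side_functional a2 a3 h1 h2 h3 hp (i := i) (j := j) hi hj
  have notMem : ∀ {l : (ℕ →₀ ZMod 2) →ₗ[ZMod 2] ZMod 2} {x : ℕ →₀ ZMod 2},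
      (∀ x ∈ spaceOff Γ₁ p, l x = 0) → l x = 1 → x ∉ spaceOff Γ₁ p := by
    intro l x hl hx hmem
    rw [hl x hmem] at hx
    exact zero_ne_one hx
  simp only [← Nat.not_even_iff_odd] at o1 o2 o3 o4 o5 side func
  -- If `p 0` is even, the coloured sides are 01, 23, 45. With classes A, B, C for them, the
  -- arrangements 1, 3, 5 contribute B + C, A + B, A + C, read off from the arcs at `p 2`, `p 0`, `p
  -- 0`.
  by_cases h0 : Even (p 0 : ℕ)
  · have e1 := o1.1 h0
    have e2 := not_not.1 (mt o2.2 e1)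
    have e3 := o3.1 e2
    have e4 := not_not.1 (mt o4.2 e3)
    have s1 := side 0 1 rfl h0 e1
    have s2 := side 2 3 rfl e2 e3
    have s3 := side 4 5 rfl e4 (o5.1 e4)
    obtain ⟨l, hl, hl'⟩ := func 0 1 h0 e1
    obtain ⟨r, hr, hr'⟩ := func 2 3 e2 e3
    rw [space_eq_sup_of_mkQ h1 a1 2, space_eq_sup_of_mkQ h2 a2 0, space_eq_sup_of_mkQ h3 a3 0]
    · refine sum_isCompl_eq_zero (notMem hr ?_) (notMem hr ?_) (notMem hl ?_) ?_
      · rw [map_add, hr', hr']; decide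
      · rw [map_add, hr', hr']; decide
      · rw [map_add, hl', hl']; decide
      · rw [← Submodule.Quotient.mk_eq_zero, ← Submodule.mkQ_apply]
        simp only [Fin.reduceSub, sub_zero, map_add, s2]
        exact eq_zero_of_eq_add_self
          ((spaceOff Γ₁ p).mkQ (intervalVec (p 3)))
          ((spaceOff Γ₁ p).mkQ (intervalVec (p 5)))
          ((spaceOff Γ₁ p).mkQ (intervalVec (p 0)))
          (by abel)
    all_goals
      intro D hD hu
      have t1 := mkQ_eq_of_le hD s1
      have t2 := mkQ_eq_of_le hD s2
      have t3 := mkQ_eq_of_le hD s3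
      simp only [Fin.reduceSub, sub_zero] at hu
      apply forall_fin_six <;> simp only [Fin.reduceSub, sub_zero, sub_self] <;> grind only
  -- Now the coloured sides are 12, 34 and 50, the last one passing through the base point.
  · have e1 := not_not.1 (mt o1.2 h0)
    have e2 := o2.1 e1
    have e3 := not_not.1 (mt o3.2 e2)
    have e4 := o4.1 e3
    have s1 := side 1 2 rfl e1 e2
    have s2 := side 3 4 rfl e3 e4
    have s3 := mkQ_outer_side a2 a3 h1 h2 h3 hp (Nat.not_even_iff_odd.1 h0)
      (not_not.1 (mt o5.2 e4))
    obtain ⟨l, hl, hl'⟩ := func 1 2 e1 e2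
    obtain ⟨r, hr, hr'⟩ := func 3 4 e3 e4
    rw [space_eq_sup_of_mkQ h1 a1 0, space_eq_sup_of_mkQ h2 a2 0, space_eq_sup_of_mkQ h3 a3 1]
    · refine sum_isCompl_eq_zero (notMem hl ?_) (notMem hr ?_) (notMem hl ?_) ?_
      · rw [map_add, hl', hl']; decide
      · rw [map_add, hr', hr']; decide
      · rw [map_add, hl', hl']; decide
      · rw [← Submodule.Quotient.mk_eq_zero, ← Submodule.mkQ_apply]
        simp only [Fin.reduceSub, sub_zero, map_add, s2]
        exact eq_zero_of_eq_add_self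
          ((spaceOff Γ₁ p).mkQ (intervalVec (p 0)))
          ((spaceOff Γ₁ p).mkQ (intervalVec (p 1)))
          ((spaceOff Γ₁ p).mkQ (intervalVec (p 4)))
          (by abel)
    all_goals
      intro D hD hu
      have t1 := mkQ_eq_of_le hD s1
      have t2 := mkQ_eq_of_le hD s2
      have t3 := mkQ_eq_of_le hD s3
      simp only [Fin.reduceSub, sub_zero] at hu
      apply forall_fin_six <;> simp only [Fin.reduceSub, sub_zero, sub_self] <;> grind only

end Triple
end ChordDiagram

/-! ### Complements under an injective map with a chosen complement of its range. -/

section LinearAlgebra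

variable {V : Type*} [AddCommGroup V] [Module (ZMod 2) V]

theorem isCompl_map_sup_iff {f : V →ₗ[ZMod 2] V} (hf : Function.Injective f)
    {T : Submodule (ZMod 2) V} (hT : IsCompl (LinearMap.range f) T) {U C : Submodule (ZMod 2) V} :
    IsCompl (U.map f) (C.map f ⊔ T) ↔ IsCompl U C := by
  have hz : ∀ x, f x ∈ T → x = 0 := fun x hx =>
    hf (by rw [map_zero, Submodule.disjoint_def.1 hT.disjoint _ ⟨x, rfl⟩ hx])
  rw [isCompl_iff, isCompl_iff, Submodule.disjoint_def, Submodule.disjoint_def,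
    codisjoint_iff, codisjoint_iff, Submodule.eq_top_iff', Submodule.eq_top_iff']
  constructor
  · rintro ⟨h1, h2⟩
    refine ⟨fun x hx hx' => ?_, fun v => ?_⟩
    · have := h1 (f x) (Submodule.mem_map_of_mem hx)
        (Submodule.mem_sup_left (Submodule.mem_map_of_mem hx'))
      exact hf (by rw [this, map_zero])
    · obtain ⟨_, ⟨a, ha, rfl⟩, y, hy, h⟩ := Submodule.mem_sup.1 (h2 (f v))
      obtain ⟨_, ⟨c, hc, rfl⟩, z, hzT, rfl⟩ := Submodule.mem_sup.1 hy
      have : v - (a + c) = 0 := by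
        apply hz
        rw [map_sub, map_add, ← h]
        convert hzT using 1
        abel
      rw [sub_eq_zero.1 this]
      exact Submodule.add_mem_sup ha hc
  · rintro ⟨h1, h2⟩
    refine ⟨?_, fun v => ?_⟩
    · rintro _ ⟨a, ha, rfl⟩ hx'
      obtain ⟨_, ⟨c, hc, rfl⟩, z, hzT, h⟩ := Submodule.mem_sup.1 hx'
      have : a - c = 0 := by
        apply hz
        rw [map_sub, ← h]
        simpa using hzT
      rw [sub_eq_zero.1 this] at ha ⊢
      rw [h1 c ha hc, map_zero]
    · have hv : v ∈ LinearMap.range f ⊔ T := by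
        rw [hT.sup_eq_top]
        trivial
      obtain ⟨_, ⟨b, rfl⟩, z, hzT, rfl⟩ := Submodule.mem_sup.1 hv
      obtain ⟨a, ha, c, hc, rfl⟩ := Submodule.mem_sup.1 (h2 b)
      rw [map_add, add_assoc]
      exact Submodule.add_mem_sup (Submodule.mem_map_of_mem ha)
        (Submodule.add_mem_sup (Submodule.mem_map_of_mem hc) hzT)

theorem isCompl_map_sup_iff' {f : V →ₗ[ZMod 2] V} (hf : Function.Injective f)
    {T : Submodule (ZMod 2) V} (hT : IsCompl (LinearMap.range f) T) {U C : Submodule (ZMod 2) V} :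
    IsCompl (U.map f ⊔ T) (C.map f) ↔ IsCompl U C := by
  rw [isCompl_comm, isCompl_map_sup_iff hf hT, isCompl_comm]

end LinearAlgebra

/-! ### Region spaces of created diagrams, the dual subspaces, and linear independence. -/

namespace ChordDiagram

section Create

variable {m : ℕ} (Γ : ChordDiagram m)

/-- The point of `createMinus Γ` which corresponds to the point `x` of `Γ`. -/
def minusPoint (m x : ℕ) : ℕ :=
  if x = 0 then 2 * m else x

theorem minusPoint_zero : minusPoint m 0 = 2 * m := rfl

theorem minusPoint_of_pos {x : ℕ} (h : 0 < x) : minusPoint m x = x := by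
  simp [minusPoint, h.ne']

theorem mate_createPlus_zero : Γ.createPlus.mate 0 = 1 := by
  have h : 0 < 2 * (m + 1) := by omega
  simp only [mate, h, dite_true, createPlus]

theorem mate_createPlus_one : Γ.createPlus.mate 1 = 0 := by
  rw [mate_eq_comm, mate_createPlus_zero]

theorem mate_createPlus_add_two (x : ℕ) : Γ.createPlus.mate (x + 2) = Γ.mate x + 2 := by
  by_cases h : x < 2 * m
  · simp [mate, createPlus, h, show x + 2 < 2 * (m + 1) by omega]
  · rw [mate_of_le _ (not_lt.1 h), mate_of_le _ (by omega)]

theorem mate_createMinus_zero : Γ.createMinus.mate 0 = 2 * m + 1 := by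
  simp [mate, createMinus]

theorem mate_createMinus_last : Γ.createMinus.mate (2 * m + 1) = 0 := by
  rw [mate_eq_comm, mate_createMinus_zero]

theorem mate_createMinus_minusPoint {x : ℕ} (h : x < 2 * m) :
    Γ.createMinus.mate (minusPoint m x) = minusPoint m (Γ.mate x) := by
  by_cases h0 : x = 0
  · subst h0
    simp [mate, createMinus, minusPoint, h, show m ≠ 0 by omega]
  · simp [mate, createMinus, minusPoint, h, h0, show x < 2 * (m + 1) by omega,
      show x ≠ 2 * m + 1 by omega, show x ≠ 2 * m by omega]

theorem eq_zero_or_last_or_minusPoint {y : ℕ} (hy : y < 2 * (m + 1)) :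
    y = 0 ∨ y = 2 * m + 1 ∨ ∃ x < 2 * m, y = minusPoint m x := by
  by_cases h0 : y = 0
  · exact Or.inl h0
  by_cases h1 : y = 2 * m + 1
  · exact Or.inr (Or.inl h1)
  by_cases h2 : y = 2 * m
  · exact Or.inr (Or.inr ⟨0, by omega, h2⟩)
  · exact Or.inr (Or.inr ⟨y, by omega, (minusPoint_of_pos (by omega)).symm⟩)

/-- The linear map which renumbers the boundary intervals when `createPlus` is applied. -/
noncomputable def plusMap : (ℕ →₀ ZMod 2) →ₗ[ZMod 2] (ℕ →₀ ZMod 2) :=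
  Finsupp.lmapDomain _ _ fun i => i + 1

/-- The linear map which renumbers the boundary intervals when `createMinus` is applied to a
diagram with `m` chords; it is extended to a bijection onto the vectors supported away from `0`. -/
noncomputable def minusMap (m : ℕ) : (ℕ →₀ ZMod 2) →ₗ[ZMod 2] (ℕ →₀ ZMod 2) :=
  Finsupp.lmapDomain _ _ fun i => if i = 0 then m else if i < m then i else i + 1

/-- The sum of the two boundary intervals at the chord added by `createMinus`. -/
noncomputable def newVec (m : ℕ) : ℕ →₀ ZMod 2 :=
  Finsupp.single 0 1 + Finsupp.single m 1

theorem plusMap_injective : Function.Injective plusMap :=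
  Finsupp.mapDomain_injective fun i j h => by simpa using h

theorem minusMap_injective : Function.Injective (minusMap m) :=
  Finsupp.mapDomain_injective fun i j h => by
    split_ifs at h <;> omega

theorem range_lmapDomain_eq {f : ℕ → ℕ} (hf : Function.Injective f)
    (h : ∀ i, i ∈ Set.range f ↔ i ≠ 0) :
    LinearMap.range (Finsupp.lmapDomain (ZMod 2) (ZMod 2) f) =
      LinearMap.ker (Finsupp.lapply (R := ZMod 2) (M := ZMod 2) 0) := by
  ext x
  have := Finsupp.mem_range_mapDomain_iff (M := ZMod 2) f hf x
  simp only [h, not_not, forall_eq] at this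
  rw [LinearMap.mem_ker, Finsupp.lapply_apply, ← this]
  rfl

theorem range_plusMap : LinearMap.range plusMap =
    LinearMap.ker (Finsupp.lapply (R := ZMod 2) (M := ZMod 2) 0) :=
  range_lmapDomain_eq (fun i j h => by simpa using h) fun i =>
    ⟨by rintro ⟨j, rfl⟩; exact j.succ_ne_zero, fun h => ⟨i - 1, by dsimp only; omega⟩⟩

theorem range_minusMap (hm : 0 < m) : LinearMap.range (minusMap m) =
    LinearMap.ker (Finsupp.lapply (R := ZMod 2) (M := ZMod 2) 0) := by
  refine range_lmapDomain_eq (fun i j h => ?_) fun i => ⟨?_, fun h => ?_⟩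
  · split_ifs at h <;> omega
  · rintro ⟨j, rfl⟩
    dsimp only
    split_ifs <;> omega
  · refine ⟨if i = m then 0 else if i < m then i else i - 1, ?_⟩
    dsimp only
    split_ifs <;> omega

theorem newVec_zero (hm : 0 < m) : newVec m 0 = 1 := by
  simp [newVec, hm.ne']

theorem isCompl_ker_span_newVec (hm : 0 < m) :
    IsCompl (LinearMap.ker (Finsupp.lapply (R := ZMod 2) (M := ZMod 2) 0))
      (Submodule.span (ZMod 2) {newVec m}) := by
  rw [isCompl_iff, Submodule.disjoint_def, codisjoint_iff, Submodule.eq_top_iff']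
  refine ⟨fun x hx hx' => ?_, fun x => ?_⟩
  · obtain ⟨c, rfl⟩ := Submodule.mem_span_singleton.1 hx'
    rw [LinearMap.mem_ker, Finsupp.lapply_apply, Finsupp.smul_apply, newVec_zero hm,
      smul_eq_mul, mul_one] at hx
    rw [hx, zero_smul]
  · refine Submodule.mem_sup.2 ⟨x - x 0 • newVec m, ?_, x 0 • newVec m,
      Submodule.smul_mem _ _ (Submodule.mem_span_singleton_self _), sub_add_cancel _ _⟩
    rw [LinearMap.mem_ker, Finsupp.lapply_apply, Finsupp.sub_apply, Finsupp.smul_apply,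
      newVec_zero hm, smul_eq_mul, mul_one, sub_self]

theorem plusMap_intervalVec (x : ℕ) : plusMap (intervalVec x) = intervalVec (x + 2) := by
  simp [plusMap, intervalVec]

/-- The new chord (0, 1) has both ends on interval 0, so it contributes zero; all other intervals
are shifted by one. -/
theorem space_createPlus : Γ.createPlus.space = Γ.space.map plusMap := by
  rw [space, space, Submodule.map_span, ← Set.range_comp]
  apply le_antisymm
  · rw [Submodule.span_le]
    rintro _ ⟨x, rfl⟩
    have h01 : intervalVec 0 + intervalVec 1 = 0 := ZModModule.add_self _
    match x with
    | 0 =>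
      simp only [mate_createPlus_zero, h01]
      exact zero_mem _
    | 1 =>
      simp only [mate_createPlus_one, add_comm, h01]
      exact zero_mem _
    | x + 2 =>
      refine Submodule.subset_span ⟨x, ?_⟩
      simp only [Function.comp_apply, map_add, plusMap_intervalVec, mate_createPlus_add_two]
  · refine Submodule.span_mono ?_
    rintro _ ⟨x, rfl⟩
    exact ⟨x + 2, by
      simp only [Function.comp_apply, map_add, plusMap_intervalVec, mate_createPlus_add_two]⟩

/-- The new chord splits the old interval 0 into the intervals 0 and `m`. `minusMap` picks the half
at `m`, so the point 1, which stays on the half at 0, is off by `newVec`. -/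
theorem minusMap_intervalVec {x : ℕ} (hx : x < 2 * m) :
    minusMap m (intervalVec x) + intervalVec (minusPoint m x) ∈
      Submodule.span (ZMod 2) {newVec m} := by
  simp only [minusMap, intervalVec, Finsupp.lmapDomain_apply, Finsupp.mapDomain_single]
  by_cases h0 : x = 0
  · subst h0
    simp [minusPoint, ZModModule.add_self]
  · rw [minusPoint_of_pos (by omega)]
    by_cases h1 : x = 1
    · subst h1
      rw [add_comm]
      exact Submodule.mem_span_singleton_self _
    · rw [if_neg (by omega), if_pos (by omega), ZModModule.add_self]
      exact zero_mem _

theorem space_createMinus :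
    Γ.createMinus.space = Γ.space.map (minusMap m) ⊔ Submodule.span (ZMod 2) {newVec m} := by
  have hnew : intervalVec 0 + intervalVec (2 * m + 1) = newVec m := by
    simp [intervalVec, newVec, show (2 * m + 1) / 2 = m by omega]
  have key : ∀ x < 2 * m, minusMap m (intervalVec x + intervalVec (Γ.mate x)) +
      (intervalVec (minusPoint m x) + intervalVec (Γ.createMinus.mate (minusPoint m x))) ∈
        Submodule.span (ZMod 2) {newVec m} := by
    intro x hx
    rw [mate_createMinus_minusPoint _ hx, map_add, add_add_add_comm]
    exact add_mem (minusMap_intervalVec hx) (minusMap_intervalVec (Γ.mate_lt hx))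
  apply le_antisymm
  · refine Submodule.span_le.2 ?_
    rintro _ ⟨y, rfl⟩
    dsimp only
    by_cases hy : y < 2 * (m + 1)
    · rcases eq_zero_or_last_or_minusPoint hy with rfl | rfl | ⟨x, hx, rfl⟩
      · rw [mate_createMinus_zero, hnew]
        exact Submodule.mem_sup_right (Submodule.mem_span_singleton_self _)
      · rw [mate_createMinus_last, add_comm, hnew]
        exact Submodule.mem_sup_right (Submodule.mem_span_singleton_self _)
      · have h1 : minusMap m (intervalVec x + intervalVec (Γ.mate x)) ∈
            Γ.space.map (minusMap m) ⊔ Submodule.span (ZMod 2) {newVec m} :=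
          Submodule.mem_sup_left (Submodule.mem_map_of_mem (Submodule.subset_span ⟨x, rfl⟩))
        exact (Submodule.add_mem_iff_right _ h1).1 (Submodule.mem_sup_right (key x hx))
    · rw [mate_of_le _ (not_lt.1 hy), ZModModule.add_self]
      exact zero_mem _
  · refine sup_le ?_ ?_
    · rw [Submodule.map_le_iff_le_comap]
      refine Submodule.span_le.2 ?_
      rintro _ ⟨x, rfl⟩
      rw [Submodule.comap_coe, Set.mem_preimage, SetLike.mem_coe]
      by_cases hx : x < 2 * m
      · have h1 : intervalVec (minusPoint m x) +
            intervalVec (Γ.createMinus.mate (minusPoint m x)) ∈ Γ.createMinus.space :=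
          Submodule.subset_span ⟨_, rfl⟩
        refine (Submodule.add_mem_iff_left _ h1).1
          ((Submodule.span_singleton_le_iff_mem _ _).2 ?_ (key x hx))
        exact Submodule.subset_span ⟨0, by simp only [mate_createMinus_zero, hnew]⟩
      · simp only [mate_of_le _ (not_lt.1 hx), ZModModule.add_self, map_zero]
        exact zero_mem _
    · rw [Submodule.span_singleton_le_iff_mem]
      exact Submodule.subset_span ⟨0, by simp only [mate_createMinus_zero, hnew]⟩

end Create

/-- The subspaces complementary to the space of exactly one of the basis diagrams. -/
noncomputable def dualSpace : (n : ℕ) → (Fin n → Bool) → Submodule (ZMod 2) (ℕ →₀ ZMod 2)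
  | 0, _ => ⊤
  | n + 1, w =>
    if w 0 then (dualSpace n (Fin.tail w)).map plusMap ⊔
      Submodule.span (ZMod 2) {newVec (n + 1)}
    else (dualSpace n (Fin.tail w)).map (minusMap (n + 1))

/-- Equal first letters reduce to the tails. If only `w` starts with −, both subspaces contain
`newVec`, so they are not disjoint. If only `w` starts with +, both lie in the hyperplane where
coordinate 0 vanishes, so they do not span. -/
theorem isCompl_space_dualSpace_iff : ∀ {n : ℕ} (w w' : Fin n → Bool),
    IsCompl (ofWord n w).space (dualSpace n w') ↔ w = w'
  | 0, w, w' => by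
    have : vacuum.space = ⊥ := by
      rw [space, Submodule.span_eq_bot]
      rintro _ ⟨x, rfl⟩
      dsimp only
      match x with
      | 0 => exact ZModModule.add_self _
      | 1 => exact ZModModule.add_self _
      | x + 2 => rw [mate_of_le _ (by omega), ZModModule.add_self]
    simp only [ofWord, dualSpace, this, Subsingleton.elim w w', iff_true]
    exact isCompl_bot_top
  | n + 1, w, w' => by
    have hm : 0 < n + 1 := n.succ_pos
    have ih := isCompl_space_dualSpace_iff (Fin.tail w) (Fin.tail w')
    have hw : w = w' ↔ w 0 = w' 0 ∧ Fin.tail w = Fin.tail w' := by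
      rw [← Fin.cons_self_tail w, ← Fin.cons_self_tail w', Fin.cons_inj]
      simp
    rw [hw, ofWord, dualSpace]
    have hK := isCompl_ker_span_newVec hm
    have hne : newVec (n + 1) ≠ 0 := fun h => by
      have := newVec_zero hm
      rw [h] at this
      exact zero_ne_one this
    cases h : w 0 <;> cases h' : w' 0
    · simp only [Bool.false_eq_true, if_false, true_and]
      rw [space_createMinus, isCompl_map_sup_iff' minusMap_injective
        (by rwa [range_minusMap hm]), ih]
    · simp only [Bool.false_eq_true, if_false, if_true, false_and, iff_false]
      rw [space_createMinus]
      intro hc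
      exact hne (Submodule.disjoint_def.1 hc.disjoint _
        (Submodule.mem_sup_right (Submodule.mem_span_singleton_self _))
        (Submodule.mem_sup_right (Submodule.mem_span_singleton_self _)))
    · simp only [Bool.false_eq_true, if_false, if_true, false_and, iff_false, reduceCtorEq]
      rw [space_createPlus]
      intro hc
      have hle : Submodule.map plusMap (ofWord n (Fin.tail w)).space ⊔
          Submodule.map (minusMap (n + 1)) (dualSpace n (Fin.tail w')) ≤
          LinearMap.ker (Finsupp.lapply (R := ZMod 2) (M := ZMod 2) 0) := by
        refine sup_le ?_ ?_
        · rw [← range_plusMap]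
          exact LinearMap.map_le_range
        · rw [← range_minusMap hm]
          exact LinearMap.map_le_range
      rw [hc.sup_eq_top] at hle
      have := hle (Submodule.mem_top : newVec (n + 1) ∈ ⊤)
      rw [LinearMap.mem_ker, Finsupp.lapply_apply, newVec_zero hm] at this
      exact one_ne_zero this
    · simp only [if_true, true_and]
      rw [space_createPlus, isCompl_map_sup_iff plusMap_injective (by rwa [range_plusMap]), ih]

open Classical in
/-- The linear map which records with which of the subspaces `dualSpace n w` the space of a chord
diagram is complementary. -/
noncomputable def coordinates (n : ℕ) : SFHcomb (n + 1) →ₗ[ZMod 2] ((Fin n → Bool) → ZMod 2) :=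
  (bypassRelations (n + 1)).liftQ
    (Finsupp.linearCombination (ZMod 2) fun (Γ : ChordDiagram (n + 1)) w =>
      if IsCompl Γ.space (dualSpace n w) then (1 : ZMod 2) else 0) (by
    rw [bypassRelations, Submodule.span_le]
    rintro _ ⟨Γ₁, Γ₂, Γ₃, h, rfl⟩
    rw [SetLike.mem_coe, LinearMap.mem_ker]
    funext w
    simp only [map_add, Finsupp.linearCombination_single, one_smul, Pi.add_apply, Pi.zero_apply]
    exact sum_isCompl_space_eq_zero h _)

theorem coordinates_ofWord {n : ℕ} (w : Fin n → Bool) :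
    coordinates n (ofWord n w).toSFH = Pi.single w 1 := by
  classical
  rw [coordinates, toSFH, ← Submodule.mkQ_apply, ← LinearMap.comp_apply, Submodule.liftQ_mkQ]
  funext w'
  simp only [Finsupp.linearCombination_single, one_smul, isCompl_space_dualSpace_iff,
    Pi.single_apply, eq_comm]

theorem linearIndependent_ofWord (n : ℕ) :
    LinearIndependent (ZMod 2) fun w : Lex (Fin n → Bool) => (ofWord n (ofLex w)).toSFH := by
  apply LinearIndependent.of_comp (coordinates n)
  have h : (coordinates n ∘ fun w : Lex (Fin n → Bool) => (ofWord n (ofLex w)).toSFH) =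
      fun w => Pi.single (ofLex w) 1 := by
    funext w
    exact coordinates_ofWord _
  rw [h]
  have hb := (Pi.basisFun (ZMod 2) (Fin n → Bool)).linearIndependent.comp
    (ofLex : Lex (Fin n → Bool) → _) ofLex.injective
  simpa only [Function.comp_def, Pi.basisFun_apply] using hb

end ChordDiagram

/-! ### Undoing a creation, and surgery along a hexagon. -/

namespace ChordDiagram

theorem exists_createPlus {m : ℕ} {Γ : ChordDiagram (m + 1)} (h : Γ.mate 0 = 1) :
    ∃ Γ', Γ = createPlus Γ' := by
  have h' : Γ.mate 1 = 0 := by rw [mate_eq_comm, h]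
  have h2 : ∀ x, 2 ≤ Γ.mate (x + 2) := by
    intro x
    by_contra hx
    have := Γ.mate_mate (x + 2)
    rcases (by omega : Γ.mate (x + 2) = 0 ∨ Γ.mate (x + 2) = 1) with h0 | h0
    · rw [h0, h] at this
      omega
    · rw [h0, h'] at this
      omega
  have hlt : ∀ x < 2 * m, Γ.mate (x + 2) < 2 * (m + 1) := fun x hx => Γ.mate_lt (by omega)
  refine ⟨ofMate (fun x => Γ.mate (x + 2) - 2) (fun x hx => ?_) (fun x hx => ?_)
    (fun x hx hx' => ?_) (fun a ha b hb h1 h2' h3 => ?_), ext_mate fun x hx => ?_⟩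
  · have := hlt x hx
    have := h2 x
    omega
  · rw [Nat.sub_add_cancel (h2 x), mate_mate, Nat.add_sub_cancel]
  · have := h2 x
    exact Γ.mate_ne (x := x + 2) (by omega) (by omega)
  · have := h2 a
    have := h2 b
    exact Γ.mate_noncrossing (a := a + 2) (b := b + 2) (by omega) (by omega) (by omega)
  · match x with
    | 0 => rw [h, mate_createPlus_zero]
    | 1 => rw [h', mate_createPlus_one]
    | x + 2 =>
      rw [mate_createPlus_add_two, mate_ofMate (by omega), Nat.sub_add_cancel (h2 x)]

theorem exists_createMinus {m : ℕ} {Γ : ChordDiagram (m + 1)} (h : Γ.mate 0 = 2 * m + 1) :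
    ∃ Γ', Γ = createMinus Γ' := by
  have h' : Γ.mate (2 * m + 1) = 0 := by rw [mate_eq_comm, h]
  have hpos : ∀ x < 2 * m, 0 < minusPoint m x ∧ minusPoint m x ≤ 2 * m := by
    intro x hx
    unfold minusPoint
    split_ifs <;> omega
  have hmate : ∀ x < 2 * m, 0 < Γ.mate (minusPoint m x) ∧ Γ.mate (minusPoint m x) ≤ 2 * m := by
    intro x hx
    have h0 := hpos x hx
    have h1 := Γ.mate_lt (x := minusPoint m x) (by omega)
    have h2 := Γ.mate_mate (minusPoint m x)
    have h3 : Γ.mate (minusPoint m x) ≠ 0 := fun h3 => by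
      rw [h3, h] at h2
      omega
    have h4 : Γ.mate (minusPoint m x) ≠ 2 * m + 1 := fun h4 => by
      rw [h4, h'] at h2
      omega
    omega
  let g : ℕ → ℕ := fun y => if y = 2 * m then 0 else y
  have hg : ∀ y, 0 < y → y ≤ 2 * m → minusPoint m (g y) = y := by
    intro y h0 h1
    simp only [g, minusPoint]
    split_ifs <;> omega
  have hg' : ∀ x < 2 * m, g (minusPoint m x) = x := by
    intro y h0
    simp only [g, minusPoint]
    split_ifs <;> omega
  refine ⟨ofMate (fun x => g (Γ.mate (minusPoint m x))) (fun x hx => ?_) (fun x hx => ?_)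
    (fun x hx hx' => ?_) (fun a ha b hb h1 h2 h3 => ?_), ext_mate fun y hy => ?_⟩
  · have := hmate x hx
    simp only [g]
    split_ifs <;> omega
  · rw [hg _ (hmate x hx).1 (hmate x hx).2, mate_mate, hg' x hx]
  · have := hpos x hx
    refine Γ.mate_ne (x := minusPoint m x) (by omega) ?_
    rw [← hg _ (hmate x hx).1 (hmate x hx).2, hx']
  · have hma := hmate a ha
    have hmb := hmate b hb
    rw [minusPoint_of_pos (by omega : 0 < b)] at h3 hmb
    have hb3 : g (Γ.mate b) = Γ.mate b := by
      by_cases hb0 : Γ.mate b = 2 * m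
      · simp only [hb0, g, if_true] at h3
        omega
      · simp only [g, if_neg hb0]
    have ha3 : g (Γ.mate (minusPoint m a)) = Γ.mate (minusPoint m a) := by
      by_cases ha0 : Γ.mate (minusPoint m a) = 2 * m
      · simp only [ha0, g, if_true] at h2
        omega
      · simp only [g, if_neg ha0]
    rw [hb3, ha3] at h3
    rw [ha3] at h2
    -- The point 0 of the smaller diagram sits at `2 * m` in `Γ`, past all others, so its chord has
    -- to be read from the opposite end.
    by_cases ha0 : a = 0
    · subst ha0
      rw [minusPoint_zero] at *
      refine Γ.mate_noncrossing h2 h3 ?_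
      have : Γ.mate b ≠ 2 * m := by
        intro hb0
        have h5 := Γ.mate_mate b
        rw [hb0] at h5
        omega
      rw [mate_mate]
      omega
    · rw [minusPoint_of_pos (by omega : 0 < a)] at *
      exact Γ.mate_noncrossing h1 h2 h3
  · rcases eq_zero_or_last_or_minusPoint hy with rfl | rfl | ⟨x, hx, rfl⟩
    · rw [h, mate_createMinus_zero]
    · rw [h', mate_createMinus_last]
    · rw [mate_createMinus_minusPoint _ hx, mate_ofMate hx, hg _ (hmate x hx).1 (hmate x hx).2]

/-- No crossing can appear: by `hsep` no remaining chord passes over any of the six points, and by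
`hk'` arrangement `k` is noncrossing in itself. -/
theorem exists_surgery {m : ℕ} {Γ : ChordDiagram m} {p : Fin 6 → Fin (2 * m)} (hp : StrictMono p)
    {k l : Fin 6} (h : HasArcs Γ p l)
    (hsep : ∀ x : ℕ, (∀ i, x ≠ p i) → ∀ i, ¬ (x < p i ∧ p i < Γ.mate x))
    (hk : ∀ i, k - i ≠ i) (hk' : ∀ i j, i < j → j < k - i → ¬ k - i < k - j) :
    ∃ Γ', AgreeOff Γ Γ' p ∧ HasArcs Γ' p k := by
  classical
  let f : ℕ → ℕ := fun x => if hx : ∃ i, x = p i then (p (k - hx.choose) : ℕ) else Γ.mate x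
  have hfp : ∀ i, f (p i) = p (k - i) := by
    intro i
    have hx : ∃ i', (p i : ℕ) = p i' := ⟨i, rfl⟩
    have : hx.choose = i := (hp.injective (Fin.ext hx.choose_spec)).symm
    simp only [f, dif_pos hx, this]
  have hfm : ∀ x : ℕ, (∀ i, x ≠ p i) → f x = Γ.mate x := by
    intro x hx
    simp only [f, dif_neg (not_exists.2 hx)]
  have cases : ∀ x : ℕ, (∃ i, x = p i) ∨ ∀ i, x ≠ p i := by
    intro x
    by_cases hx : ∃ i, x = p i
    · exact Or.inl hx
    · exact Or.inr (not_exists.1 hx)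
  refine ⟨ofMate f (fun x hx => ?_) (fun x hx => ?_) (fun x hx => ?_) (fun a ha b hb => ?_),
    fun x hx => ?_, fun i => ?_⟩
  · rcases cases x with ⟨i, rfl⟩ | hx'
    · rw [hfp]
      exact (p _).2
    · rw [hfm x hx']
      exact Γ.mate_lt hx
  · rcases cases x with ⟨i, rfl⟩ | hx'
    · rw [hfp, hfp, sub_sub_cancel]
    · rw [hfm x hx', hfm _ (h.mate_ne_point hx'), mate_mate]
  · rcases cases x with ⟨i, rfl⟩ | hx'
    · rw [hfp]
      exact fun h' => hk i (hp.injective (Fin.ext h'))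
    · rw [hfm x hx']
      exact Γ.mate_ne hx
  · intro h1 h2 h3
    rcases cases a with ⟨i, rfl⟩ | ha'
    · rcases cases b with ⟨j, rfl⟩ | hb'
      · rw [hfp, hfp] at h3
        rw [hfp] at h2
        rw [Fin.val_fin_lt, hp.lt_iff_lt] at h1 h2 h3
        exact hk' i j h1 h2 h3
      · rw [hfp] at h2 h3
        rw [hfm b hb'] at h3
        exact hsep b hb' _ ⟨h2, h3⟩
    · rcases cases b with ⟨j, rfl⟩ | hb'
      · rw [hfm a ha'] at h2
        exact hsep a ha' _ ⟨h1, h2⟩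
      · rw [hfm a ha'] at h2 h3
        rw [hfm b hb'] at h3
        exact Γ.mate_noncrossing h1 h2 h3
  · apply Fin.ext
    rw [← mate_val, ← mate_val, mate_ofMate x.2, hfm]
    exact fun i hi => hx ⟨i, (Fin.ext hi).symm⟩
  · apply Fin.ext
    rw [← mate_val, mate_ofMate (p i).2, hfp]

/-- A diagram whose chord at the base point is not outermost is in a bypass triple with a diagram
in the image of `createPlus` and one in the image of `createMinus`. -/
theorem exists_createPlus_createMinus {n : ℕ} {Γ : ChordDiagram (n + 2)} (h1 : Γ.mate 0 ≠ 1)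
    (h2 : Γ.mate 0 ≠ 2 * n + 3) :
    ∃ Γ₁ Γ₂ : ChordDiagram (n + 1), ∃ p : Fin 6 → Fin (2 * (n + 2)), StrictMono p ∧
      (p 0 : ℕ) = 0 ∧ (p 1 : ℕ) = 1 ∧ (p 5 : ℕ) = 2 * n + 3 ∧
      AgreeOff (createPlus Γ₁) Γ p ∧ AgreeOff (createPlus Γ₁) (createMinus Γ₂) p ∧
      HasArcs (createPlus Γ₁) p 1 ∧ HasArcs Γ p 3 ∧ HasArcs (createMinus Γ₂) p 5 := by
  have l0 := Γ.mate_lt (x := 0) (by omega)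
  have l1 := Γ.mate_lt (x := 1) (by omega)
  have l2 := Γ.mate_lt (x := 2 * n + 3) (by omega)
  have n0 := Γ.mate_ne (x := 0) (by omega)
  have n1 := Γ.mate_ne (x := 1) (by omega)
  have n2 := Γ.mate_ne (x := 2 * n + 3) (by omega)
  have m0 := Γ.mate_mate 0
  have m1 := Γ.mate_mate 1
  have m2 := Γ.mate_mate (2 * n + 3)
  have n3 : Γ.mate 1 ≠ 0 := fun h => by rw [h] at m1; exact h1 m1
  have n4 : Γ.mate (2 * n + 3) ≠ 0 := fun h => by rw [h] at m2; exact h2 m2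
  have n5 : Γ.mate 1 < Γ.mate 0 := by
    by_contra h
    have : Γ.mate 1 ≠ Γ.mate 0 := fun h' => by rw [h', m0] at m1; omega
    exact Γ.mate_noncrossing (a := 0) (b := 1) (by omega) (by omega) (by omega)
  have n6 : Γ.mate 0 < Γ.mate (2 * n + 3) := by
    by_contra h
    have : Γ.mate (2 * n + 3) ≠ Γ.mate 0 := fun h' => by rw [h', m0] at m2; omega
    refine Γ.mate_noncrossing (a := 0) (b := Γ.mate (2 * n + 3)) (by omega) (by omega) ?_
    rw [m2]
    omega
  -- The six ends of the chords at 0, 1 and the last point, in increasing order. `Γ` has arrangement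
  -- 3 there; arrangement 1 creates the outermost chord (0, 1), and arrangement 5 the chord from 0
  -- to the last point.
  let p : Fin 6 → Fin (2 * (n + 2)) := ![⟨0, by omega⟩, ⟨1, by omega⟩, ⟨Γ.mate 1, l1⟩,
    ⟨Γ.mate 0, l0⟩, ⟨Γ.mate (2 * n + 3), l2⟩, ⟨2 * n + 3, by omega⟩]
  have hp : StrictMono p := by
    rw [Fin.strictMono_iff_lt_succ]
    intro i
    fin_cases i <;> simp [p, Fin.lt_def] <;> omega
  have h3 : HasArcs Γ p 3 := by
    rw [hasArcs_iff]
    apply forall_fin_six <;> simp [p, m0, m1, m2] <;> rfl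
  have hsep : ∀ x : ℕ, (∀ i, x ≠ p i) → ∀ i, ¬ (x < p i ∧ p i < Γ.mate x) := by
    intro x hx
    have e0 : (p 0 : ℕ) = 0 := rfl
    have e1 : (p 1 : ℕ) = 1 := rfl
    have e5 : (p 5 : ℕ) = 2 * n + 3 := rfl
    have x0 := hx 0
    have g0 : ¬ (x < p 0 ∧ p 0 < Γ.mate x) := by omega
    have g1 : ¬ (x < p 1 ∧ p 1 < Γ.mate x) := by omega
    have g5 : ¬ (x < p 5 ∧ p 5 < Γ.mate x) := by
      rintro ⟨h, h'⟩
      have := Γ.mate_lt (x := x) (by omega)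
      omega
    apply forall_fin_six
    · exact g0
    · exact g1
    · exact fun h => g1 (h3.inside hx h)
    · exact fun h => g0 (h3.inside hx h)
    · exact fun h => g5 (h3.inside hx h)
    · exact g5
  obtain ⟨Γ₁, a1, b1⟩ := exists_surgery hp h3 hsep (k := 1) (by decide) (by decide)
  obtain ⟨Γ₂, a2, b2⟩ := exists_surgery hp h3 hsep (k := 5) (by decide) (by decide)
  obtain ⟨Γ₁, rfl⟩ := exists_createPlus (Γ := Γ₁) ((hasArcs_iff.1 b1) 0)
  obtain ⟨Γ₂, rfl⟩ := exists_createMinus (Γ := Γ₂) ((hasArcs_iff.1 b2) 0)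
  exact ⟨Γ₁, Γ₂, p, hp, rfl, rfl, rfl, fun x hx => (a1 x hx).symm,
    fun x hx => (a1 x hx).symm.trans (a2 x hx), b1, h3, b2⟩

end ChordDiagram

/-! ### Peelability: an intrinsic test for basis diagrams. -/

/-- The chords `f` on the `2 * k` points from `l` on can be removed one after another, each of them
being outermost at the base point, which is the first point of the interval (`true`) or its last
point (`false`), and which moves as in `createPlus` and `createMinus`. -/
def IsPeelable (f : ℕ → ℕ) : ℕ → Bool → ℕ → Prop
  | 0, _, _ => True
  | k + 1, true, l => (f l = l + 1 ∧ IsPeelable f k true (l + 2)) ∨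
      (f l = l + 2 * k + 1 ∧ IsPeelable f k false (l + 1))
  | k + 1, false, l => (f (l + 2 * k) = l + 2 * k + 1 ∧ IsPeelable f k false l) ∨
      (f l = l + 2 * k + 1 ∧ IsPeelable f k true (l + 1))

namespace IsPeelable

theorem translate_iff {f g : ℕ → ℕ} {d : ℕ} : ∀ {k : ℕ} {s : Bool} {l : ℕ},
    (∀ x, l ≤ x → x < l + 2 * k → g (x + d) = f x + d) →
    (IsPeelable g k s (l + d) ↔ IsPeelable f k s l)
  | 0, _, _, _ => Iff.rfl
  | k + 1, true, l, h => by
    have ih1 := translate_iff (k := k) (s := true) (l := l + 2) fun x h1 h2 =>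
      h x (by omega) (by omega)
    have ih2 := translate_iff (k := k) (s := false) (l := l + 1) fun x h1 h2 =>
      h x (by omega) (by omega)
    rw [IsPeelable, IsPeelable, ← ih1, ← ih2, h l le_rfl (by omega)]
    rw [add_right_comm l 2 d, add_right_comm l 1 d]
    refine or_congr (and_congr_left' ?_) (and_congr_left' ?_) <;> omega
  | k + 1, false, l, h => by
    have ih1 := translate_iff (k := k) (s := false) (l := l) fun x h1 h2 =>
      h x (by omega) (by omega)
    have ih2 := translate_iff (k := k) (s := true) (l := l + 1) fun x h1 h2 =>
      h x (by omega) (by omega)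
    rw [IsPeelable, IsPeelable, ← ih1, ← ih2, h l le_rfl (by omega), add_right_comm l d (2 * k),
      h (l + 2 * k) (by omega) (by omega), add_right_comm l 1 d]
    refine or_congr (and_congr_left' ?_) (and_congr_left' ?_) <;> omega

theorem congr_iff {f g : ℕ → ℕ} {k : ℕ} {s : Bool} {l : ℕ}
    (h : ∀ x, l ≤ x → x < l + 2 * k → g x = f x) : IsPeelable g k s l ↔ IsPeelable f k s l :=
  translate_iff (d := 0) h

/-- A chord starting among the first 2i points cannot reach the far end of the interval, so while
the base point is there only short chords can be peeled. -/
theorem prefix_iff {f : ℕ → ℕ} {k : ℕ} : ∀ {i l : ℕ},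
    (∀ x, l ≤ x → x < l + 2 * i → f x < l + 2 * i) →
    (IsPeelable f (i + (k + 1)) true l ↔
      (∀ t < i, f (l + 2 * t) = l + 2 * t + 1) ∧ IsPeelable f (k + 1) true (l + 2 * i))
  | 0, l, _ => by simp
  | i + 1, l, h => by
    have ih := prefix_iff (f := f) (k := k) (i := i) (l := l + 2) fun x h1 h2 => by
      have := h x (by omega) (by omega)
      omega
    have h0 := h l le_rfl (by omega)
    rw [show i + 1 + (k + 1) = i + (k + 1) + 1 by ring, IsPeelable, ih,
      show l + 2 * (i + 1) = l + 2 + 2 * i by ring]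
    constructor
    · rintro (⟨h1, h2, h3⟩ | ⟨h1, -⟩)
      · refine ⟨fun t ht => ?_, h3⟩
        match t with
        | 0 => exact h1
        | t + 1 =>
          have := h2 t (by omega)
          rw [show l + 2 * (t + 1) = l + 2 + 2 * t by ring, this]
      · omega
    · rintro ⟨h1, h2⟩
      refine Or.inl ⟨h1 0 (by omega), fun t ht => ?_, h2⟩
      have := h1 (t + 1) (by omega)
      rwa [show l + 2 * (t + 1) = l + 2 + 2 * t by ring] at this

/-- The bound on `f l` excludes the chord joining the two ends of the interval, so the last 2i
points can only be peeled as short chords. -/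
theorem suffix_iff {f : ℕ → ℕ} {k l : ℕ} (h : f l < l + 2 * (k + 1)) : ∀ {i : ℕ},
    (IsPeelable f (i + (k + 1)) false l ↔
      (∀ t < i, f (l + 2 * (k + 1) + 2 * t) = l + 2 * (k + 1) + 2 * t + 1) ∧
        IsPeelable f (k + 1) false l)
  | 0 => by simp
  | i + 1 => by
    have ih := suffix_iff h (i := i)
    rw [show i + 1 + (k + 1) = i + (k + 1) + 1 by ring, IsPeelable, ih,
      show l + 2 * (i + (k + 1)) = l + 2 * (k + 1) + 2 * i by ring]
    constructor
    · rintro (⟨h1, h2, h3⟩ | ⟨h1, -⟩)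
      · refine ⟨fun t ht => ?_, h3⟩
        rcases Nat.lt_succ_iff_lt_or_eq.1 ht with ht | rfl
        · exact h2 t ht
        · exact h1
      · omega
    · rintro ⟨h1, h2⟩
      exact Or.inl ⟨h1 i (by omega), fun t ht => h1 t (by omega), h2⟩

theorem wrapped_true_iff {f : ℕ → ℕ} {k l : ℕ} (h : f l = l + 2 * k + 1) :
    IsPeelable f (k + 1) true l ↔ IsPeelable f k false (l + 1) := by
  rw [IsPeelable]
  match k with
  | 0 => simp [IsPeelable, h]
  | k + 1 =>
    constructor
    · rintro (⟨h1, -⟩ | ⟨-, h2⟩)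
      · omega
      · exact h2
    · exact fun h2 => Or.inr ⟨h, h2⟩

theorem wrapped_false_iff {f : ℕ → ℕ} (hf : Function.Injective f) {k l : ℕ}
    (h : f l = l + 2 * k + 1) : IsPeelable f (k + 1) false l ↔ IsPeelable f k true (l + 1) := by
  rw [IsPeelable]
  match k with
  | 0 => simp [IsPeelable, h]
  | k + 1 =>
    constructor
    · rintro (⟨h1, -⟩ | ⟨-, h2⟩)
      · have := hf (h1.trans h.symm)
        omega
      · exact h2
    · exact fun h2 => Or.inr ⟨h, h2⟩

end IsPeelable

/-- The common part of two configurations of chords related by a bypass move. -/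
theorem IsPeelable.surgery_iff {f g : ℕ → ℕ} (hf : Function.Injective f)
    (hg : Function.Injective g) {i y z w a j b e : ℕ} (ha : a = 2 + 2 * i) (hj : j = a + 1 + 2 * y)
    (hb : b = j + 1 + 2 * z) (he : e = b + 1 + 2 * w) (fa : f a = e) (fj : f j = b)
    (gb : g 1 = b) (ga : g a = j) (s1 : ∀ x, 1 < x → x < a → f x < a)
    (s2 : ∀ x, a < x → x < j → f x < j) (d1 : ∀ x, 1 < x → x < a → g x = f x)
    (d2 : ∀ x, a < x → x < j → g x = f x) (d3 : ∀ x, j < x → x < b → g x = f x)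
    (d4 : ∀ x, b < x → x < e → g x = f x) :
    IsPeelable f (i + (w + (y + z + 1) + 1)) true 2 ↔
      IsPeelable g (w + (i + (y + z + 1) + 1)) false 1 := by
  -- Both peelings require short chords in the two sectors with `i` and `w` chords. What is left
  -- offers the same choice on both sides: either z = 0 and the sector between `a` and `j` is peeled
  -- from its last point, or y = 0 and the one between `j` and `b` from its first.
  have L2 : IsPeelable f (y + z + 1) false (a + 1) ↔
      (z = 0 ∧ IsPeelable f y false (a + 1)) ∨ (y = 0 ∧ IsPeelable f z true (a + 1 + 1)) := by
    rw [IsPeelable, show a + 1 + 2 * (y + z) + 1 = b by omega, ← fj, hf.eq_iff, hf.eq_iff]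
    refine or_congr ?_ ?_
    · rw [show a + 1 + 2 * (y + z) = j ↔ z = 0 by omega]
      refine and_congr_right fun h => ?_
      rw [h, add_zero]
    · rw [show a + 1 = j ↔ y = 0 by omega]
      refine and_congr_right fun h => ?_
      rw [h, zero_add]
  have R2 : IsPeelable g (y + z + 1) true a ↔
      (z = 0 ∧ IsPeelable g y false (a + 1)) ∨ (y = 0 ∧ IsPeelable g z true (a + 1 + 1)) := by
    rw [IsPeelable, ga, or_comm]
    refine or_congr ?_ ?_
    · rw [show j = a + 2 * (y + z) + 1 ↔ z = 0 by omega]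
      refine and_congr_right fun h => ?_
      rw [h, add_zero]
    · rw [show j = a + 1 ↔ y = 0 by omega]
      refine and_congr_right fun h => ?_
      rw [h, zero_add]
  rw [IsPeelable.prefix_iff (fun x h1 h2 => by rw [← ha] at h2 ⊢; exact s1 x h1 h2), ← ha,
    IsPeelable.wrapped_true_iff (by omega), IsPeelable.suffix_iff, L2, IsPeelable.suffix_iff,
    IsPeelable.wrapped_false_iff hg (by omega), IsPeelable.prefix_iff, ← ha, R2]
  · rw [← and_assoc, ← and_assoc]
    refine and_congr (and_comm.trans (and_congr ?_ ?_)) (or_congr ?_ ?_)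
    · refine forall₂_congr fun t ht => ?_
      rw [show a + 1 + 2 * (y + z + 1) + 2 * t = 1 + 2 * (i + (y + z + 1) + 1) + 2 * t by omega,
        d4 _ (by omega) (by omega)]
    · refine forall₂_congr fun t ht => ?_
      rw [show 1 + 1 + 2 * t = 2 + 2 * t by omega, d1 _ (by omega) (by omega)]
    · refine and_congr_right fun h => (IsPeelable.congr_iff fun x h1 h2 => ?_).symm
      exact d2 x (by omega) (by omega)
    · refine and_congr_right fun h => (IsPeelable.congr_iff fun x h1 h2 => ?_).symm
      exact d3 x (by omega) (by omega)
  · intro x h1 h2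
    rw [d1 x (by omega) (by omega)]
    have := s1 x (by omega) (by omega)
    omega
  · omega
  · by_cases hy : y = 0
    · rw [show a + 1 = j by omega, fj]
      omega
    · have := s2 (a + 1) (by omega) (by omega)
      omega

/-! ### Basis diagrams are the peelable ones; the crux of the induction. -/

namespace ChordDiagram

theorem mate_injective {m : ℕ} (Γ : ChordDiagram m) : Function.Injective Γ.mate :=
  Function.Involutive.injective Γ.mate_mate

theorem isPeelable_createPlus_iff {n : ℕ} (Γ : ChordDiagram (n + 1)) :
    IsPeelable (createPlus Γ).mate (n + 2) true 0 ↔ IsPeelable Γ.mate (n + 1) true 0 := by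
  have h := IsPeelable.translate_iff (f := Γ.mate) (g := (createPlus Γ).mate) (d := 2)
    (k := n + 1) (s := true) (l := 0) fun x _ _ => Γ.mate_createPlus_add_two x
  rw [← h, IsPeelable, mate_createPlus_zero]
  constructor
  · rintro (⟨-, h2⟩ | ⟨h1, -⟩)
    · exact h2
    · omega
  · exact fun h2 => Or.inl ⟨rfl, h2⟩

/-- Once the outer chord is gone, the base point is the last point `2 * (n + 1)` instead of the
first point 0 of `Γ`. The two alternatives for the next chord trade places, and beyond it the chords
coincide. -/
theorem isPeelable_createMinus_iff {n : ℕ} (Γ : ChordDiagram (n + 1)) :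
    IsPeelable (createMinus Γ).mate (n + 2) true 0 ↔ IsPeelable Γ.mate (n + 1) true 0 := by
  have hpos : ∀ x, 0 < x → x < 2 * (n + 1) → 0 < Γ.mate x →
      (createMinus Γ).mate x = Γ.mate x := by
    intro x h0 h1 h2
    have := Γ.mate_createMinus_minusPoint h1
    rwa [minusPoint_of_pos h0, minusPoint_of_pos h2] at this
  have h0 := Γ.mate_createMinus_minusPoint (x := 0) (by omega)
  have hn := Γ.mate_ne (x := 0) (by omega)
  rw [minusPoint_zero, minusPoint_of_pos (by omega)] at h0
  rw [IsPeelable.wrapped_true_iff (by rw [mate_createMinus_zero]; ring), IsPeelable, IsPeelable,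
    or_comm]
  have h1 : (createMinus Γ).mate (0 + 1) = 0 + 1 + 2 * n + 1 ↔ Γ.mate 0 = 0 + 1 := by
    rw [mate_eq_comm, show 0 + 1 + 2 * n + 1 = 2 * (n + 1) by ring, h0]
  have h2 : (createMinus Γ).mate (0 + 1 + 2 * n) = 0 + 1 + 2 * n + 1 ↔
      Γ.mate 0 = 0 + 2 * n + 1 := by
    rw [mate_eq_comm, show 0 + 1 + 2 * n + 1 = 2 * (n + 1) by ring, h0,
      show 0 + 1 + 2 * n = 0 + 2 * n + 1 by ring]
  rw [h1, h2]
  have inner : ∀ x, Γ.mate 0 ≠ x → 0 < Γ.mate x := by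
    intro x hx
    rw [Ne, mate_eq_comm] at hx
    omega
  refine or_congr (and_congr_right fun h => ?_) (and_congr_right fun h => ?_)
  · exact IsPeelable.congr_iff fun x h1 h2 => hpos x (by omega) (by omega) (inner x (by omega))
  · exact IsPeelable.congr_iff fun x h1 h2 => hpos x (by omega) (by omega) (inner x (by omega))

theorem exists_eq_ofWord_iff : ∀ {n : ℕ} (Γ : ChordDiagram (n + 1)),
    (∃ w, Γ = ofWord n w) ↔ IsPeelable Γ.mate (n + 1) true 0
  | 0, Γ => by
    have h0 := Γ.mate_lt (x := 0) (by omega)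
    have h1 := Γ.mate_ne (x := 0) (by omega)
    have h2 : Γ.mate 0 = 1 := by omega
    refine iff_of_true ⟨0, ext_mate fun x hx => ?_⟩ (Or.inl ⟨h2, trivial⟩)
    have h3 : Γ.mate 1 = 0 := by rw [mate_eq_comm, h2]
    match x, hx with
    | 0, _ => exact h2
    | 1, _ => exact h3
  | n + 1, Γ => by
    constructor
    · rintro ⟨w, rfl⟩
      rw [ofWord]
      split_ifs
      · rw [isPeelable_createPlus_iff, ← exists_eq_ofWord_iff]
        exact ⟨_, rfl⟩
      · rw [isPeelable_createMinus_iff, ← exists_eq_ofWord_iff]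
        exact ⟨_, rfl⟩
    · intro h
      have h' := h
      rw [IsPeelable] at h'
      rcases h' with ⟨h0, -⟩ | ⟨h0, -⟩
      · obtain ⟨Γ, rfl⟩ := exists_createPlus h0
        rw [isPeelable_createPlus_iff, ← exists_eq_ofWord_iff] at h
        obtain ⟨w, rfl⟩ := h
        exact ⟨Fin.cons true w, by simp [ofWord]⟩
      · obtain ⟨Γ, rfl⟩ := exists_createMinus (h0.trans (by ring))
        rw [isPeelable_createMinus_iff, ← exists_eq_ofWord_iff] at h
        obtain ⟨w, rfl⟩ := h
        exact ⟨Fin.cons false w, by simp [ofWord]⟩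

/-- Adding an outermost chord at the base point does not affect peelability, so the two created
diagrams can be compared instead. They agree off the hexagon, and `IsPeelable.surgery_iff` shows
that peeling imposes the same conditions on the sectors of both. -/
theorem exists_ofWord_iff_exists_ofWord {n : ℕ} {Γ : ChordDiagram (n + 2)}
    {Γ₁ Γ₂ : ChordDiagram (n + 1)} {p : Fin 6 → Fin (2 * (n + 2))} (hp : StrictMono p)
    (p0 : (p 0 : ℕ) = 0) (p1 : (p 1 : ℕ) = 1) (p5 : (p 5 : ℕ) = 2 * n + 3)
    (a2 : AgreeOff (createPlus Γ₁) Γ p) (a3 : AgreeOff (createPlus Γ₁) (createMinus Γ₂) p)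
    (h1 : HasArcs (createPlus Γ₁) p 1) (h2 : HasArcs Γ p 3) (h3 : HasArcs (createMinus Γ₂) p 5) :
    (∃ w, Γ₁ = ofWord n w) ↔ ∃ w, Γ₂ = ofWord n w := by
  rw [exists_eq_ofWord_iff, exists_eq_ofWord_iff, ← isPeelable_createPlus_iff Γ₁,
    ← isPeelable_createMinus_iff Γ₂]
  have odd := fun i j (hij : j.val = i.val + 1) => even_iff_odd_of_consecutive a2 a3 h1 h2 h3 (i := i) (j := j)
    (hp (by rw [Fin.lt_def]; omega)) (no_point_between hp hij)
  have sector := fun i j (hij : j.val = i.val + 1) (x : ℕ) (hi : p i < x) (hj : x < p j) =>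
    mate_mem_sector a2 a3 h1 h2 h3 hi hj (no_point_between hp hij x hi hj)
  have agree := fun i j (hij : j.val = i.val + 1) (x : ℕ) (hi : p i < x) (hj : x < p j) =>
    (agreeOff_iff.1 a3 x (no_point_between hp hij x hi hj)).symm
  have o2 := odd 1 2 rfl
  have o3 := odd 2 3 rfl
  have o4 := odd 3 4 rfl
  have t1 : p 1 < p 2 := hp (by decide)
  have t2 : p 2 < p 3 := hp (by decide)
  have t3 : p 3 < p 4 := hp (by decide)
  have t4 : p 4 < p 5 := hp (by decide)
  rw [hasArcs_iff] at h1 h3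
  have b0 := h1 0
  have b2 := h1 2
  have b3 := h1 3
  have c0 := h3 0
  have c1 := h3 1
  have c2 := h3 2
  rw [show (1 : Fin 6) - 0 = 1 from rfl] at b0
  rw [show (1 : Fin 6) - 2 = 5 from rfl] at b2
  rw [show (1 : Fin 6) - 3 = 4 from rfl] at b3
  rw [show (5 : Fin 6) - 0 = 5 from rfl] at c0
  rw [show (5 : Fin 6) - 1 = 4 from rfl] at c1
  rw [show (5 : Fin 6) - 2 = 3 from rfl] at c2
  have s1 := sector 1 2 rfl
  have s2 := sector 2 3 rfl
  have d1 := agree 1 2 rfl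
  have d2 := agree 2 3 rfl
  have d3 := agree 3 4 rfl
  have d4 := agree 4 5 rfl
  rw [Fin.lt_def] at t1 t2 t3 t4
  rw [p1] at t1 s1 d1 c1 o2
  rw [p0] at b0 c0
  -- The numbers `i`, `y`, `z`, `w` count the chords in the four sectors between `p 1` and `p 5`;
  -- parity makes them integers.
  obtain ⟨i, hi⟩ : ∃ i, (p 2 : ℕ) = 2 + 2 * i := ⟨(p 2 - 2) / 2, by grind⟩
  obtain ⟨y, hy⟩ : ∃ y, (p 3 : ℕ) = p 2 + 1 + 2 * y := ⟨(p 3 - p 2 - 1) / 2, by grind⟩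
  obtain ⟨z, hz⟩ : ∃ z, (p 4 : ℕ) = p 3 + 1 + 2 * z := ⟨(p 4 - p 3 - 1) / 2, by grind⟩
  obtain ⟨w, hw⟩ : ∃ w, (p 5 : ℕ) = p 4 + 1 + 2 * w := ⟨(p 5 - p 4 - 1) / 2, by grind⟩
  have key := IsPeelable.surgery_iff (mate_injective (createPlus Γ₁))
    (mate_injective (createMinus Γ₂)) hi hy hz hw b2 b3 c1 c2 (fun x h h' => (s1 x h h').2)
    (fun x h h' => (s2 x h h').2) d1 d2 d3 d4
  rw [show i + (w + (y + z + 1) + 1) = n + 1 by omega,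
    show w + (i + (y + z + 1) + 1) = n + 1 by omega] at key
  rw [IsPeelable.wrapped_true_iff (f := (createMinus Γ₂).mate) (by omega), ← key, IsPeelable, b0]
  constructor
  · rintro (⟨-, h⟩ | ⟨h, -⟩)
    · exact h
    · omega
  · intro h
    exact Or.inl ⟨by rw [p1], h⟩

end ChordDiagram

/-! ### Creation operations preserve bypass relations and induce linear maps. -/

namespace ChordDiagram

section Create

variable {m : ℕ}

theorem exists_createPlus_points {p : Fin 6 → Fin (2 * m)} (hp : StrictMono p) :
    ∃ q : Fin 6 → Fin (2 * (m + 1)), StrictMono q ∧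
      (∀ (Γ : ChordDiagram m) k, HasArcs Γ p k → HasArcs (createPlus Γ) q k) ∧
      ∀ Γ Γ' : ChordDiagram m, AgreeOff Γ Γ' p → AgreeOff (createPlus Γ) (createPlus Γ') q := by
  refine ⟨fun i => ⟨p i + 2, by omega⟩, fun i j h => ?_, fun Γ k h => ?_, fun Γ Γ' h => ?_⟩
  · have := hp h
    rw [Fin.lt_def] at this ⊢
    dsimp only
    omega
  · rw [hasArcs_iff] at h ⊢
    intro i
    dsimp only
    rw [mate_createPlus_add_two, h]
  · rw [agreeOff_iff] at h ⊢
    intro x hx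
    match x with
    | 0 => rw [mate_createPlus_zero, mate_createPlus_zero]
    | 1 => rw [mate_createPlus_one, mate_createPlus_one]
    | x + 2 =>
      rw [mate_createPlus_add_two, mate_createPlus_add_two, h]
      intro i hi
      exact hx i (by rw [hi])

theorem exists_createMinus_points {p : Fin 6 → Fin (2 * m)} (hp : StrictMono p) :
    ∃ (q : Fin 6 → Fin (2 * (m + 1))) (s : Fin 6), StrictMono q ∧ (s = 0 ∨ s = 4) ∧
      (∀ (Γ : ChordDiagram m) k, HasArcs Γ p k → HasArcs (createMinus Γ) q (k + s)) ∧
      ∀ Γ Γ' : ChordDiagram m, AgreeOff Γ Γ' p → AgreeOff (createMinus Γ) (createMinus Γ') q := by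
  have hlt : ∀ x < 2 * m, minusPoint m x < 2 * (m + 1) := by
    intro x hx
    unfold minusPoint
    split_ifs <;> omega
  -- Here `c` is a cyclic shift of the six labels. Shifting turns the reflection i ↦ k - i into i ↦
  -- k - 2c - i, whence s = -2c.
  have key : ∀ c s : Fin 6, s + c + c = 0 → ∀ q : Fin 6 → Fin (2 * (m + 1)),
      (∀ i, (q i : ℕ) = minusPoint m (p (i + c))) →
      (∀ (Γ : ChordDiagram m) k, HasArcs Γ p k → HasArcs (createMinus Γ) q (k + s)) ∧
      ∀ Γ Γ' : ChordDiagram m, AgreeOff Γ Γ' p →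
        AgreeOff (createMinus Γ) (createMinus Γ') q := by
    intro c s hs q hq
    refine ⟨fun Γ k h => ?_, fun Γ Γ' h => ?_⟩
    · rw [hasArcs_iff] at h ⊢
      intro i
      rw [hq, hq, mate_createMinus_minusPoint _ (p _).2, h]
      congr 3
      rw [← sub_eq_zero, ← neg_eq_zero, ← hs]
      abel
    · rw [agreeOff_iff] at h ⊢
      intro y hy
      by_cases hy' : y < 2 * (m + 1)
      · rcases eq_zero_or_last_or_minusPoint hy' with rfl | rfl | ⟨x, hx, rfl⟩
        · rw [mate_createMinus_zero, mate_createMinus_zero]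
        · rw [mate_createMinus_last, mate_createMinus_last]
        · rw [mate_createMinus_minusPoint _ hx, mate_createMinus_minusPoint _ hx, h]
          intro i hi
          exact hy (i - c) (by rw [hq, sub_add_cancel, hi])
      · rw [mate_of_le _ (not_lt.1 hy'), mate_of_le _ (not_lt.1 hy')]
  -- If the old base point is among the six, it moves behind the other five, and the labels rotate
  -- by one.
  by_cases h0 : (p 0 : ℕ) = 0
  · refine ⟨fun i => ⟨minusPoint m (p (i + 1)), hlt _ (p _).2⟩, 4, ?_, Or.inr rfl,
      key 1 4 rfl _ fun _ => rfl⟩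
    have hpos : ∀ i, 0 < i → minusPoint m (p i) = p i := by
      intro i hi
      have := hp hi
      rw [Fin.lt_def] at this
      exact minusPoint_of_pos (by omega)
    rw [Fin.strictMono_iff_lt_succ]
    intro i
    rw [Fin.lt_def]
    have e1 : i.castSucc + 1 = i.succ := by simp
    dsimp only
    rw [e1, hpos _ (Fin.succ_pos i)]
    by_cases h5 : i.succ = 5
    · rw [h5, show (5 : Fin 6) + 1 = 0 from rfl, h0, minusPoint_zero]
      exact (p 5).2
    · have h6 : i.succ < i.succ + 1 := by
        revert h5
        revert i
        decide
      rw [hpos _ (lt_of_le_of_lt (Fin.zero_le _) h6)]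
      exact hp h6
  · refine ⟨fun i => ⟨minusPoint m (p (i + 0)), hlt _ (p _).2⟩, 0, fun i j h => ?_, Or.inl rfl,
      key 0 0 rfl _ fun _ => rfl⟩
    have hpos : ∀ i, minusPoint m (p i) = p i := by
      intro i
      have := hp.monotone (Fin.zero_le i)
      rw [Fin.le_def] at this
      exact minusPoint_of_pos (by omega)
    rw [Fin.lt_def]
    simp only [add_zero, hpos]
    exact hp h

theorem BypassRelated.createPlus {Γ Γ' : ChordDiagram m} (h : BypassRelated Γ Γ') :
    BypassRelated Γ.createPlus Γ'.createPlus := by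
  obtain ⟨p, hp, ha, k, hk, l, hl, hkl, h1, h2⟩ := h
  obtain ⟨q, hq, hq1, hq2⟩ := exists_createPlus_points hp
  exact ⟨q, hq, hq2 _ _ ha, k, hk, l, hl, hkl, hq1 _ _ h1, hq1 _ _ h2⟩

theorem BypassRelated.createMinus {Γ Γ' : ChordDiagram m} (h : BypassRelated Γ Γ') :
    BypassRelated Γ.createMinus Γ'.createMinus := by
  obtain ⟨p, hp, ha, k, hk, l, hl, hkl, h1, h2⟩ := h
  obtain ⟨q, s, hq, hs, hq1, hq2⟩ := exists_createMinus_points hp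
  have hadd : ∀ k ∈ ({1, 3, 5} : Set (Fin 6)), k + s ∈ ({1, 3, 5} : Set (Fin 6)) := by
    rintro k (rfl | rfl | rfl) <;> rcases hs with rfl | rfl <;> decide
  exact ⟨q, hq, hq2 _ _ ha, k + s, hadd k hk, l + s, hadd l hl,
    fun h => hkl (add_right_cancel h), hq1 _ _ h1, hq1 _ _ h2⟩

variable {Γ₁ Γ₂ Γ₃ : ChordDiagram m}

theorem BypassTriple.sum_mem (h : BypassTriple Γ₁ Γ₂ Γ₃) :
    Finsupp.single Γ₁ 1 + Finsupp.single Γ₂ 1 + Finsupp.single Γ₃ 1 ∈ bypassRelations m :=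
  Submodule.subset_span ⟨Γ₁, Γ₂, Γ₃, h, rfl⟩

theorem BypassTriple.toSFH_eq (h : BypassTriple Γ₁ Γ₂ Γ₃) :
    Γ₂.toSFH = Γ₃.toSFH + Γ₁.toSFH := by
  have h1 : Γ₁.toSFH + Γ₂.toSFH + Γ₃.toSFH = 0 :=
    (Submodule.Quotient.mk_eq_zero (bypassRelations m)).2 h.sum_mem
  rw [← sub_eq_zero, ← h1, ZModModule.sub_eq_add]
  abel

theorem BypassTriple.createPlus (h : BypassTriple Γ₁ Γ₂ Γ₃) :
    BypassTriple Γ₁.createPlus Γ₂.createPlus Γ₃.createPlus := by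
  obtain ⟨p, hp, a2, a3, h1, h2, h3⟩ := h
  obtain ⟨q, hq, hq1, hq2⟩ := exists_createPlus_points hp
  exact ⟨q, hq, hq2 _ _ a2, hq2 _ _ a3, hq1 _ _ h1, hq1 _ _ h2, hq1 _ _ h3⟩

/-- A rotation of the labels permutes the arrangements 1, 3, 5 cyclically, so the triple may return
in another cyclic order. -/
theorem BypassTriple.createMinus (h : BypassTriple Γ₁ Γ₂ Γ₃) :
    BypassTriple Γ₁.createMinus Γ₂.createMinus Γ₃.createMinus ∨
      BypassTriple Γ₂.createMinus Γ₃.createMinus Γ₁.createMinus := by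
  obtain ⟨p, hp, a2, a3, h1, h2, h3⟩ := h
  obtain ⟨q, s, hq, hs, hq1, hq2⟩ := exists_createMinus_points hp
  have b2 := hq2 _ _ a2
  have b3 := hq2 _ _ a3
  have c1 := hq1 _ _ h1
  have c2 := hq1 _ _ h2
  have c3 := hq1 _ _ h3
  rcases hs with rfl | rfl
  · exact Or.inl ⟨q, hq, b2, b3, c1, c2, c3⟩
  · exact Or.inr ⟨q, hq, fun x hx => (b2 x hx).symm.trans (b3 x hx), fun x hx => (b2 x hx).symm,
      c2, c3, c1⟩

/-- The linear map induced by `createPlus`. -/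
noncomputable def plusHom (m : ℕ) : SFHcomb m →ₗ[ZMod 2] SFHcomb (m + 1) :=
  Submodule.mapQ _ _ (Finsupp.lmapDomain _ _ ChordDiagram.createPlus) (by
    rw [bypassRelations, Submodule.span_le]
    rintro _ ⟨Γ₁, Γ₂, Γ₃, h, rfl⟩
    simpa [Finsupp.mapDomain_add] using h.createPlus.sum_mem)

/-- The linear map induced by `createMinus`. -/
noncomputable def minusHom (m : ℕ) : SFHcomb m →ₗ[ZMod 2] SFHcomb (m + 1) :=
  Submodule.mapQ _ _ (Finsupp.lmapDomain _ _ ChordDiagram.createMinus) (by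
    rw [bypassRelations, Submodule.span_le]
    rintro _ ⟨Γ₁, Γ₂, Γ₃, h, rfl⟩
    rcases h.createMinus with h | h
    · simpa [Finsupp.mapDomain_add] using h.sum_mem
    · rw [add_rotate]
      simpa [Finsupp.mapDomain_add] using h.sum_mem)

theorem plusHom_toSFH (Γ : ChordDiagram m) : plusHom m Γ.toSFH = Γ.createPlus.toSFH := by
  rw [plusHom, toSFH, Submodule.mapQ_apply]
  simp [toSFH]

theorem minusHom_toSFH (Γ : ChordDiagram m) : minusHom m Γ.toSFH = Γ.createMinus.toSFH := by
  rw [minusHom, toSFH, Submodule.mapQ_apply]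
  simp [toSFH]

end Create

end ChordDiagram

/-! ### Lists paired off by a relation. -/

/-- The list has even length, and its entries number `2 * j` and `2 * j + 1` are related. -/
def List.PairedBy {α : Type*} (R : α → α → Prop) : List α → Prop
  | [] => True
  | [_] => False
  | a :: b :: l => R a b ∧ l.PairedBy R

namespace List.PairedBy

variable {α β : Type*} {R : α → α → Prop} {S : β → β → Prop}

theorem append : ∀ {l l' : List α}, l.PairedBy R → l'.PairedBy R → (l ++ l').PairedBy R
  | [], _, _, h' => h'
  | [_], _, h, _ => h.elim
  | _ :: _ :: _, _, h, h' => ⟨h.1, append h.2 h'⟩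

theorem map {f : α → β} (hf : ∀ a b, R a b → S (f a) (f b)) :
    ∀ {l : List α}, l.PairedBy R → (l.map f).PairedBy S
  | [], _ => trivial
  | [_], h => h.elim
  | _ :: _ :: _, h => ⟨hf _ _ h.1, map hf h.2⟩

theorem exists_length_eq : ∀ {l : List α}, l.PairedBy R → ∃ k, l.length = 2 * k
  | [], _ => ⟨0, rfl⟩
  | [_], h => h.elim
  | _ :: _ :: _, h => by
    obtain ⟨k, hk⟩ := exists_length_eq h.2
    exact ⟨k + 1, by simp only [List.length_cons, hk]; ring⟩

theorem getElem : ∀ {l : List α}, l.PairedBy R → ∀ (j : ℕ) (h : 2 * j + 1 < l.length),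
    R l[2 * j] l[2 * j + 1]
  | [], _, j, h => by simp at h
  | [_], h', _, _ => h'.elim
  | _ :: _ :: _, h', 0, _ => h'.1
  | a :: b :: l, h', j + 1, h => by
    have h1 : 2 * j + 1 < l.length := by
      simp only [List.length_cons] at h
      omega
    exact getElem h'.2 j h1

end List.PairedBy

/-! ### Paired decompositions, and spanning. -/

namespace ChordDiagram

/-- The word with first letter `b` and remaining letters `w`. -/
def consWord {n : ℕ} (b : Bool) (w : Lex (Fin n → Bool)) : Lex (Fin (n + 1) → Bool) :=
  toLex (Fin.cons b (ofLex w) : Fin (n + 1) → Bool)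

theorem consWord_lt_consWord {n : ℕ} (b : Bool) {w w' : Lex (Fin n → Bool)} (h : w < w') :
    consWord b w < consWord b w' := by
  obtain ⟨i, hi, hlt⟩ := h
  refine ⟨i.succ, fun j hj => ?_, hlt⟩
  induction j using Fin.cases with
  | zero => rfl
  | succ j => exact hi j (Fin.succ_lt_succ_iff.1 hj)

theorem consWord_false_lt_consWord_true {n : ℕ} (w w' : Lex (Fin n → Bool)) :
    consWord false w < consWord true w' :=
  ⟨0, fun j hj => absurd hj (Fin.not_lt_zero j), Bool.false_lt_true⟩

/-- The class of the basis diagram of a word. -/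
noncomputable def wordSFH {n : ℕ} (w : Lex (Fin n → Bool)) : SFHcomb (n + 1) :=
  (ofWord n (ofLex w)).toSFH

/-- The basis diagrams of the two words are bypass-related. -/
def WordRelated {n : ℕ} (w w' : Lex (Fin n → Bool)) : Prop :=
  BypassRelated (ofWord n (ofLex w)) (ofWord n (ofLex w'))

theorem ofWord_consWord_true {n : ℕ} (w : Lex (Fin n → Bool)) :
    ofWord (n + 1) (ofLex (consWord true w)) = createPlus (ofWord n (ofLex w)) := by
  simp [ofWord, consWord]

theorem ofWord_consWord_false {n : ℕ} (w : Lex (Fin n → Bool)) :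
    ofWord (n + 1) (ofLex (consWord false w)) = createMinus (ofWord n (ofLex w)) := by
  simp [ofWord, consWord]

/-- The list of words `l` is a decomposition of the class of `Γ` as in the main theorem. -/
structure IsDecomposition {n : ℕ} (Γ : ChordDiagram (n + 1)) (l : List (Lex (Fin n → Bool))) :
    Prop where
  sorted : l.Pairwise (· < ·)
  paired : l.PairedBy WordRelated
  sum_eq : (l.map wordSFH).sum = Γ.toSFH

namespace IsDecomposition

variable {n : ℕ}

theorem createPlus {Γ : ChordDiagram (n + 1)} {l : List (Lex (Fin n → Bool))}
    (h : IsDecomposition Γ l) : IsDecomposition Γ.createPlus (l.map (consWord true)) where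
  sorted := List.pairwise_map.2 (h.sorted.imp (consWord_lt_consWord true))
  paired := h.paired.map fun a b hab => by
    rw [WordRelated, ofWord_consWord_true, ofWord_consWord_true]
    exact BypassRelated.createPlus hab
  sum_eq := by
    rw [← plusHom_toSFH, ← h.sum_eq, map_list_sum, List.map_map, List.map_map]
    congr 2
    funext w
    simp only [Function.comp_apply, wordSFH, plusHom_toSFH, ofWord_consWord_true]

theorem createMinus {Γ : ChordDiagram (n + 1)} {l : List (Lex (Fin n → Bool))}
    (h : IsDecomposition Γ l) : IsDecomposition Γ.createMinus (l.map (consWord false)) where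
  sorted := List.pairwise_map.2 (h.sorted.imp (consWord_lt_consWord false))
  paired := h.paired.map fun a b hab => by
    rw [WordRelated, ofWord_consWord_false, ofWord_consWord_false]
    exact BypassRelated.createMinus hab
  sum_eq := by
    rw [← minusHom_toSFH, ← h.sum_eq, map_list_sum, List.map_map, List.map_map]
    congr 2
    funext w
    simp only [Function.comp_apply, wordSFH, minusHom_toSFH, ofWord_consWord_false]

end IsDecomposition

theorem exists_isDecomposition : ∀ {n : ℕ} (Γ : ChordDiagram (n + 1)),
    (∀ w, Γ ≠ ofWord n w) → ∃ l, IsDecomposition Γ l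
  | 0, Γ, h => by
    have h0 := Γ.mate_lt (x := 0) (by omega)
    have h1 := Γ.mate_ne (x := 0) (by omega)
    -- The only diagram with one chord is a basis diagram, so there is nothing to decompose.
    obtain ⟨w, hw⟩ := (exists_eq_ofWord_iff Γ).2 (Or.inl ⟨by omega, trivial⟩)
    exact absurd hw (h w)
  | n + 1, Γ, h => by
    by_cases h1 : Γ.mate 0 = 1
    · obtain ⟨Γ, rfl⟩ := exists_createPlus h1
      obtain ⟨l, hl⟩ := exists_isDecomposition Γ fun w hw =>
        h (Fin.cons true w) (by simp [ofWord, hw])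
      exact ⟨_, hl.createPlus⟩
    by_cases h2 : Γ.mate 0 = 2 * n + 3
    · obtain ⟨Γ, rfl⟩ := exists_createMinus (h2.trans (by ring))
      obtain ⟨l, hl⟩ := exists_isDecomposition Γ fun w hw =>
        h (Fin.cons false w) (by simp [ofWord, hw])
      exact ⟨_, hl.createMinus⟩
    obtain ⟨Γ₁, Γ₂, p, hp, p0, p1, p5, a2, a3, b1, b2, b3⟩ := exists_createPlus_createMinus h1 h2
    have hiff := exists_ofWord_iff_exists_ofWord hp p0 p1 p5 a2 a3 b1 b2 b3
    have hsum := BypassTriple.toSFH_eq ⟨p, hp, a2, a3, b1, b2, b3⟩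
    -- By `hiff` the mixed case, which would leave an unpaired word, does not occur.
    by_cases hw : ∃ w, Γ₁ = ofWord n w
    · obtain ⟨w₂, rfl⟩ := hiff.1 hw
      obtain ⟨w₁, rfl⟩ := hw
      refine ⟨[consWord false (toLex w₂), consWord true (toLex w₁)], ?_, ⟨?_, trivial⟩, ?_⟩
      · simpa using consWord_false_lt_consWord_true _ _
      · rw [WordRelated, ofWord_consWord_false, ofWord_consWord_true]
        exact ⟨p, hp, fun x hx => (a3 x hx).symm, 5, by simp, 1, by simp, by decide, b3, b1⟩
      · simp only [List.map_cons, List.map_nil, List.sum_cons, List.sum_nil, add_zero, wordSFH,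
          ofWord_consWord_false, ofWord_consWord_true, hsum, ofLex_toLex]
    · obtain ⟨l₁, d₁⟩ := exists_isDecomposition Γ₁ (not_exists.1 hw)
      obtain ⟨l₂, d₂⟩ := exists_isDecomposition Γ₂ (not_exists.1 fun h => hw (hiff.2 h))
      refine ⟨l₂.map (consWord false) ++ l₁.map (consWord true), ?_,
        d₂.createMinus.paired.append d₁.createPlus.paired, ?_⟩
      · refine List.pairwise_append.2 ⟨d₂.createMinus.sorted, d₁.createPlus.sorted, ?_⟩
        intro a ha b hb
        obtain ⟨w, -, rfl⟩ := List.mem_map.1 ha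
        obtain ⟨w', -, rfl⟩ := List.mem_map.1 hb
        exact consWord_false_lt_consWord_true w w'
      · rw [List.map_append, List.sum_append, d₂.createMinus.sum_eq, d₁.createPlus.sum_eq, hsum]

theorem span_wordSFH (n : ℕ) :
    ⊤ ≤ Submodule.span (ZMod 2) (Set.range (wordSFH (n := n))) := by
  have key : ∀ Γ : ChordDiagram (n + 1),
      Γ.toSFH ∈ Submodule.span (ZMod 2) (Set.range (wordSFH (n := n))) := by
    intro Γ
    by_cases h : ∃ w, Γ = ofWord n w
    · obtain ⟨w, rfl⟩ := h
      exact Submodule.subset_span ⟨toLex w, rfl⟩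
    · obtain ⟨l, hl⟩ := exists_isDecomposition Γ (not_exists.1 h)
      rw [← hl.sum_eq]
      refine list_sum_mem fun x hx => ?_
      obtain ⟨w, -, rfl⟩ := List.mem_map.1 hx
      exact Submodule.subset_span ⟨w, rfl⟩
  rintro x -
  obtain ⟨y, rfl⟩ := Submodule.mkQ_surjective _ x
  induction y using Finsupp.induction_linear with
  | zero => exact zero_mem _
  | add a b ha hb => exact add_mem ha hb
  | single Γ c =>
    have : Finsupp.single Γ c = c • Finsupp.single Γ 1 := by simp
    rw [this, map_smul]
    exact Submodule.smul_mem _ _ (key Γ)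

end ChordDiagram


/-! ### The basis and the paired support. -/

theorem mainTheorem7 (n : ℕ) :
    ∃ v : Module.Basis (Lex (Fin n → Bool)) (ZMod 2) (SFHcomb (n + 1)),
      (∀ w, v w = (ChordDiagram.ofWord n (ofLex w)).toSFH) ∧
      ∀ Γ : ChordDiagram (n + 1), (∀ w, Γ ≠ ChordDiagram.ofWord n w) →
        ∃ (k : ℕ) (h : (v.repr Γ.toSFH).support.card = 2 * k), ∀ j : Fin k,
          ChordDiagram.BypassRelated
            (ChordDiagram.ofWord n (ofLex
              ((v.repr Γ.toSFH).support.orderEmbOfFin h ⟨2 * j.val, by omega⟩)))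
            (ChordDiagram.ofWord n (ofLex
              ((v.repr Γ.toSFH).support.orderEmbOfFin h ⟨2 * j.val + 1, by omega⟩))) := by
  let v := Module.Basis.mk (ChordDiagram.linearIndependent_ofWord n)
    (ChordDiagram.span_wordSFH n)
  have hv : ∀ w, v w = ChordDiagram.wordSFH w := fun w => Module.Basis.mk_apply _ _ w
  refine ⟨v, hv, fun Γ hΓ => ?_⟩
  obtain ⟨l, hl⟩ := ChordDiagram.exists_isDecomposition Γ hΓ
  have hnodup : l.Nodup := hl.sorted.imp ne_of_lt
  have hrepr : v.repr Γ.toSFH = ∑ w ∈ l.toFinset, Finsupp.single w 1 := by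
    rw [← hl.sum_eq, ← List.sum_toFinset _ hnodup, map_sum]
    refine Finset.sum_congr rfl fun w _ => ?_
    rw [← hv, Module.Basis.repr_self]
  have hsupp : (v.repr Γ.toSFH).support = l.toFinset := by
    ext w
    simp [hrepr, Finsupp.finsetSum_apply, Finsupp.single_apply]
  obtain ⟨k, hk⟩ := hl.paired.exists_length_eq
  have hcard : (v.repr Γ.toSFH).support.card = 2 * k := by
    rw [hsupp, List.toFinset_card_of_nodup hnodup, hk]
  -- A strictly increasing list of the support is its order enumeration, so the pairing of the list
  -- is the pairing by rank.
  have hemb := Finset.orderEmbOfFin_unique hcard (f := fun i => l[i]'(by omega))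
    (fun i => by rw [hsupp, List.mem_toFinset]; exact List.getElem_mem _)
    (fun i j hij => List.pairwise_iff_getElem.1 hl.sorted _ _ _ _ hij)
  refine ⟨k, hcard, fun j => ?_⟩
  rw [← hemb]
  exact hl.paired.getElem j (by omega)
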